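/- **Conventions.** Let $K,M\ge 1$, let $a_1,\dots,a_K>0$ be weights, $d_1,\dots,d_K\ge 0$ integers (dimensions), $\lambda_1,\dots,\lambda_M>0$ (eigenvalues), and $N=\sum_k d_k$. List each weight $a_k$ repeated $d_k$ times as $\{a_{k,j}\}_{k=1,j=1}^{K,\ d_k}$, with $a_{k,j}=a_k$. *Spectral tetris ready.* Sequences $(b_n)_{n=1}^{N'}$ and $(\mu_m)_{m=1}^M$ of positive reals are spectral tetris ready with partition $0=n_0<1\le n_1<\cdots<n_M=N'$ if $\sum_{n=1}^{N'} b_n^2=\sum_{m=1}^M\mu_m$ and, for all $k=1,\dots,M-1$, (i) $\sum_{n\le n_k}b_n^2\le\sum_{m\le k}\mu_m<\sum_{n\le n_k+1}b_n^2$, and (ii) if $\sum_{n\le n_k}b_n^2<\sum_{m\le k}\mu_m$, then $n_{k+1}-n_k\ge 2$ and $b_{n_k+2}^2\ge\sum_{m\le k}\mu_m-\sum_{n\le n_k}b_n^2$. *STC.* Given such sequences, the spectral tetris construction outputs $f_1,\dots,f_{N'}\in\mathbb R^M$ as follows. Start with $m=n=1$ and variables $x_m=\mu_m$. Until all $N'$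 vectors are written: if $x_m=0$, increase $m$ by $1$; if $x_m\ne 0$ and $x_m\ge b_n^2$, put $f_n=b_ne_m$ (a singleton), replace $x_m$ by $x_m-b_n^2$ and $n$ by $n+1$; otherwise, with $x=x_m$ and $y=b_n^2+b_{n+1}^2-x$, put (a block) $$f_n=\sqrt{\tfrac{x(b_n^2-y)}{x-y}}\,e_m+\sqrt{\tfrac{y(x-b_n^2)}{x-y}}\,e_{m+1},\qquad f_{n+1}=\sqrt{\tfrac{x(x-b_n^2)}{x-y}}\,e_m-\sqrt{\tfrac{y(b_n^2-y)}{x-y}}\,e_{m+1}$$ (and $f_n=\sqrt{x/2}\,(e_m+e_{m+1})$, $f_{n+1}=\sqrt{x/2}\,(e_m-e_{m+1})$ if $x=y$), replace $x_{m+1}$ by $x_{m+1}-y$, $x_m$ by $0$, $m$ by $m+1$ and $n$ by $n+2$. A *spectral tetris frame* is a frame obtained in this way from some spectral tetris ready sequences. *Spectral tetris fusion frames.* A fusion frame $\{W_k,\nu_k\}_{k=1}^K$ for $\mathbb R^M$ (weights $\nu_k>0$, orthogonal projections $P_k$ onto the subspaces $W_k$, and constants $0<A\le B$ with $A\|v\|^2\le\sum_k\nu_k^2\|P_kv\|^2\le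 B\|v\|^2$ for all $v$) has fusion frame operator $S=\sum_k\nu_k^2P_k$. It is a spectral tetris fusion frame if there are a spectral tetris frame $\{f_n\}_{n=1}^{N'}$ (any $N'$) with frame operator $S$ and a partition $\{J_k\}_{k=1}^K$ of $\{1,\dots,N'\}$ such that each $\{f_n\}_{n\in J_k}$ is a tight frame for $W_k$ with bound $\nu_k^2$. *Spectral tetris can construct* the data $(a_k),(d_k),(\lambda_m)$ if there is a spectral tetris fusion frame $\{W_k,a_k\}_{k=1}^K$ with $\dim W_k=d_k$ for all $k$ whose fusion frame operator has the eigenvalues $\lambda_1,\dots,\lambda_M$, counted with multiplicity. **Theorem.** (1) Spectral tetris can construct the data $(a_k),(d_k),(\lambda_m)$ if and only if there are an ordering $(a_{\sigma n})_{n=1}^N$ of $\{a_{k,j}\}$ and a permutation $(\lambda_{\sigma'm})_{m=1}^M$ that are spectral tetris ready with a partition $0=n_0<n_1<\cdots<n_M=N$ satisfying, for all $k=0,\dots,M-1$: (A) if $\sum_{n\le n_k}a_{\sigma n}^2<\sum_{m\le k}\lambda_{\sigma'm}$, then - (a) if $\sum_{n\le n_{k+1}}a_{\sigma n}^2<\sum_{m\le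 k+1}\lambda_{\sigma'm}$, then any two terms $a_{i,j},a_{p,q}$ at different positions among $\{a_{\sigma n}\}_{n=n_k+1}^{n_{k+1}+2}$ have $i\ne p$; - (b) if $\sum_{n\le n_{k+1}}a_{\sigma n}^2=\sum_{m\le k+1}\lambda_{\sigma'm}$, then any two terms $a_{i,j},a_{p,q}$ at different positions among $\{a_{\sigma n}\}_{n=n_k+1}^{n_{k+1}}$ have $i\ne p$; (B) if $\sum_{n\le n_k}a_{\sigma n}^2=\sum_{m\le k}\lambda_{\sigma'm}$, then - (a) if $\sum_{n\le n_{k+1}}a_{\sigma n}^2<\sum_{m\le k+1}\lambda_{\sigma'm}$, then any two terms $a_{i,j},a_{p,q}$ at different positions among $\{a_{\sigma n}\}_{n=n_k+1}^{n_{k+1}+2}$ have $i\ne p$; - (b) if $\sum_{n\le n_{k+1}}a_{\sigma n}^2=\sum_{m\le k+1}\lambda_{\sigma'm}$, then any two terms $a_{i,j},a_{p,q}$ at different positions among $\{a_{\sigma n}\}_{n=n_k+1}^{n_{k+1}}$ have $i\ne p$. (2) Equivalently, spectral tetris can construct the data if and only if there are spectral tetris ready $(a_{\sigma n})$ and $(\lambda_{\sigma'm})$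 as above for which any two distinct vectors of the STC output that come from copies of the same weight (equal first index $k$ in $a_{k,j}$) are orthogonal. (3) For each individual spectral tetris ready pair $(a_{\sigma n})$, $(\lambda_{\sigma'm})$, with its partition, conditions (A)–(B) imply the orthogonality in (2); and the converse holds whenever the inequality $a_{\sigma(n_k+2)}^2\ge\sum_{m\le k}\lambda_{\sigma'm}-\sum_{n\le n_k}a_{\sigma n}^2$ in (ii) is strict for every block. -/

import Mathlib

noncomputable section

namespace SpectralTetris

/-! ### Frames and fusion frames in `ℝ^M` -/

/-- `ℝ^M` with its Euclidean structure. -/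
abbrev Eucl (M : ℕ) : Type := EuclideanSpace ℝ (Fin M)

/-- The finite family `f` is a frame for `ℝ^M`. -/
def IsFrame {M : ℕ} {ι : Type} [Fintype ι] (f : ι → Eucl M) : Prop :=
  ∃ A B : ℝ, 0 < A ∧ A ≤ B ∧ ∀ v : Eucl M,
    A * ‖v‖ ^ 2 ≤ ∑ n, (inner ℝ v (f n)) ^ 2 ∧
    ∑ n, (inner ℝ v (f n)) ^ 2 ≤ B * ‖v‖ ^ 2

/-- The frame operator `v ↦ ∑ n, ⟨v, f n⟩ f n`. -/
def frameOperator {M : ℕ} {ι : Type} [Fintype ι] (f : ι → Eucl M) : Eucl M →L[ℝ] Eucl M :=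
  ∑ n, (innerSL ℝ (f n)).smulRight (f n)

/-- The finite family `f` is a tight frame, with frame bound `c`, for the subspace `W`. -/
def IsTightFrameFor {M : ℕ} {ι : Type} [Fintype ι]
    (W : Submodule ℝ (Eucl M)) (f : ι → Eucl M) (c : ℝ) : Prop :=
  0 < c ∧ (∀ n, f n ∈ W) ∧ ∀ v ∈ W, ∑ n, (inner ℝ v (f n)) ^ 2 = c * ‖v‖ ^ 2

/-- The subspaces `W k` with weights `ν k` form a fusion frame for `ℝ^M`. -/
def IsFusionFrame {M K : ℕ} (W : Fin K → Submodule ℝ (Eucl M)) (ν : Fin K → ℝ) : Prop :=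
  (∀ k, 0 < ν k) ∧ ∃ A B : ℝ, 0 < A ∧ A ≤ B ∧ ∀ v : Eucl M,
    A * ‖v‖ ^ 2 ≤ ∑ k, ν k ^ 2 * ‖(W k).starProjection v‖ ^ 2 ∧
    ∑ k, ν k ^ 2 * ‖(W k).starProjection v‖ ^ 2 ≤ B * ‖v‖ ^ 2

/-- The fusion frame operator `∑ k, ν k ^ 2 P_k`, with `P_k` the orthogonal projection onto
`W k`. -/
def fusionFrameOperator {M K : ℕ} (W : Fin K → Submodule ℝ (Eucl M)) (ν : Fin K → ℝ) :
    Eucl M →L[ℝ] Eucl M :=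
  ∑ k, ν k ^ 2 • (W k).starProjection

/-- The eigenvalues of `S`, counted with multiplicity, are `lam 0, …, lam (M - 1)`
in some order. -/
def HasEigenvalues {M : ℕ} (S : Eucl M →L[ℝ] Eucl M) (lam : Fin M → ℝ) : Prop :=
  (LinearMap.charpoly (S : Eucl M →ₗ[ℝ] Eucl M)).roots = Finset.univ.val.map lam

/-! ### Spectral tetris ready sequences -/

/-- A finite sequence as a function on `ℕ`, by zero outside its range. Positions count from `0`,
so the `n`-th term of the sequence (counted from `1`) is `seqAt b (n - 1)`. -/
def seqAt {N : ℕ} (b : Fin N → ℝ) (n : ℕ) : ℝ := if h : n < N then b ⟨n, h⟩ else 0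

/-- The sum of the first `k` terms. -/
def partialSum {M : ℕ} (lam : Fin M → ℝ) (k : ℕ) : ℝ := ∑ i ∈ Finset.range k, seqAt lam i

/-- The sum of the squares of the first `n` terms. -/
def partialSqSum {N : ℕ} (b : Fin N → ℝ) (n : ℕ) : ℝ := ∑ i ∈ Finset.range n, seqAt b i ^ 2

/-- The norms `b` and eigenvalues `lam` (in this order) are spectral tetris ready with partition
`1 ≤ p 1 < p 2 < ⋯ < p M = N`. We put `p 0 = 0`, so that `1 ≤ p 1` reads `p 0 < p 1`. -/
structure IsReady {M N : ℕ} (b : Fin N → ℝ) (lam : Fin M → ℝ) (p : ℕ → ℕ) : Prop where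
  norms_pos : ∀ n, 0 < b n
  eigenvalues_pos : ∀ m, 0 < lam m
  total : ∑ n, b n ^ 2 = ∑ m, lam m
  start : p 0 = 0
  strict : ∀ k, k < M → p k < p (k + 1)
  last : p M = N
  cut : ∀ k, 1 ≤ k → k < M →
    partialSqSum b (p k) ≤ partialSum lam k ∧ partialSum lam k < partialSqSum b (p k + 1)
  /-- `seqAt b (p k + 1)` is the term number `p k + 2` when one counts from `1`. -/
  block : ∀ k, 1 ≤ k → k < M → partialSqSum b (p k) < partialSum lam k →
    p k + 2 ≤ p (k + 1) ∧ partialSum lam k - partialSqSum b (p k) ≤ seqAt b (p k + 1) ^ 2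

/-! ### The spectral tetris construction -/

/-- A state of the algorithm: the cursor `(row, col)` (counted from `0`), the current values of
the eigenvalue variables, and the vectors written so far, as sequences of coordinates. -/
structure State where
  row : ℕ
  col : ℕ
  lam : ℕ → ℝ
  vec : ℕ → ℕ → ℝ

/-- The coordinates of the standard basis vector `e_m`. -/
def e (m : ℕ) : ℕ → ℝ := Pi.single m 1

/-- One step of the algorithm with norms `b`, dimension `M` and `N` vectors. It stops when all
vectors are written (or the rows are exhausted); it moves to the next row when the current
eigenvalue variable is zero; otherwise it writes a singleton, or a `2 × 2` block. -/
def step (M N : ℕ) (b : ℕ → ℝ) (s : State) : State :=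
  open Classical in
  let m := s.row
  let n := s.col
  let x := s.lam m
  let y := b n ^ 2 + b (n + 1) ^ 2 - x
  if N ≤ n ∨ M ≤ m then s
  else if x = 0 then { s with row := m + 1 }
  else if b n ^ 2 ≤ x then
    { row := m
      col := n + 1
      lam := Function.update s.lam m (x - b n ^ 2)
      vec := Function.update s.vec n (b n • e m) }
  else
    { row := m + 1
      col := n + 2
      lam := Function.update (Function.update s.lam (m + 1) (s.lam (m + 1) - y)) m 0
      vec :=
        if 2 * x = b n ^ 2 + b (n + 1) ^ 2 then
          Function.update
            (Function.update s.vec n (√(x / 2) • (e m + e (m + 1))))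
            (n + 1) (√(x / 2) • (e m - e (m + 1)))
        else
          Function.update
            (Function.update s.vec n
              (√(x * (b n ^ 2 - y) / (x - y)) • e m +
                √(y * (x - b n ^ 2) / (x - y)) • e (m + 1)))
            (n + 1)
              (√(x * (x - b n ^ 2) / (x - y)) • e m -
                √(y * (b n ^ 2 - y) / (x - y)) • e (m + 1)) }

/-- The vectors that the algorithm outputs for norms `b` and eigenvalues `lam`. Every step before
the stop advances the cursor, so `M + N` steps are enough. -/
def stc {M N : ℕ} (b : Fin N → ℝ) (lam : Fin M → ℝ) (n : Fin N) : Eucl M :=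
  WithLp.toLp 2 fun m : Fin M =>
    ((step M N (seqAt b))^[M + N]
      { row := 0, col := 0, lam := seqAt lam, vec := fun _ _ => 0 }).vec n m

/-- A spectral tetris frame: a frame that the algorithm outputs for some spectral tetris ready
sequences of norms and eigenvalues. -/
def IsSpectralTetrisFrame {M N : ℕ} (f : Fin N → Eucl M) : Prop :=
  IsFrame f ∧ ∃ (b : Fin N → ℝ) (lam : Fin M → ℝ) (p : ℕ → ℕ), IsReady b lam p ∧ f = stc b lam

/-- A spectral tetris fusion frame: a fusion frame for which there are a spectral tetris frame `f`
with the same frame operator and a partition of its index set (`J n = k` says that `n` lies in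
the `k`-th part) such that the `k`-th subfamily is a tight frame for `W k` with bound `ν k ^ 2`. -/
def IsSpectralTetrisFusionFrame {M K : ℕ} (W : Fin K → Submodule ℝ (Eucl M))
    (ν : Fin K → ℝ) : Prop :=
  IsFusionFrame W ν ∧
    ∃ (N : ℕ) (f : Fin N → Eucl M) (J : Fin N → Fin K),
      IsSpectralTetrisFrame f ∧
      frameOperator f = fusionFrameOperator W ν ∧
      ∀ k, IsTightFrameFor (W k) (fun n : {n : Fin N // J n = k} => f n) (ν k ^ 2)

/-- Spectral tetris can construct a fusion frame whose subspaces have the weights `a` and the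
dimensions `d`, and whose fusion frame operator has the eigenvalues `lam`. -/
def Constructible {M K : ℕ} (a : Fin K → ℝ) (d : Fin K → ℕ) (lam : Fin M → ℝ) : Prop :=
  ∃ W : Fin K → Submodule ℝ (Eucl M),
    (∀ k, Module.finrank ℝ (W k) = d k) ∧
    IsSpectralTetrisFusionFrame W a ∧
    HasEigenvalues (fusionFrameOperator W a) lam

/-! ### Orderings of the repeated weights and the window conditions -/

/-- No two of the terms number `lo + 1, …, hi` (counted from `1`) carry the same label. -/
def NoRepeat {N K : ℕ} (c : Fin N → Fin K) (lo hi : ℕ) : Prop :=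
  ∀ i j : Fin N, lo ≤ i.val → i.val < hi → lo ≤ j.val → j.val < hi → i ≠ j → c i ≠ c j

/-- Conditions (A) and (B), for norms `b`, eigenvalues `lam`, partition `p` and labels `c` (the
term number `n` is a copy of the weight number `c n`). The windows run over the terms
`p k + 1, …, p (k + 1) + 2` or `p k + 1, …, p (k + 1)`, counted from `1`: exactly the columns in
which the algorithm writes to row `k + 1`. The first row is `k = 0`, with `p 0 = 0`. -/
structure WindowConditions {M N K : ℕ} (b : Fin N → ℝ) (lam : Fin M → ℝ) (p : ℕ → ℕ)
    (c : Fin N → Fin K) : Prop where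
  Aa : ∀ k, k < M → partialSqSum b (p k) < partialSum lam k →
    partialSqSum b (p (k + 1)) < partialSum lam (k + 1) → NoRepeat c (p k) (p (k + 1) + 2)
  Ab : ∀ k, k < M → partialSqSum b (p k) < partialSum lam k →
    partialSqSum b (p (k + 1)) = partialSum lam (k + 1) → NoRepeat c (p k) (p (k + 1))
  Ba : ∀ k, k < M → partialSqSum b (p k) = partialSum lam k →
    partialSqSum b (p (k + 1)) < partialSum lam (k + 1) → NoRepeat c (p k) (p (k + 1) + 2)
  Bb : ∀ k, k < M → partialSqSum b (p k) = partialSum lam k →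
    partialSqSum b (p (k + 1)) = partialSum lam (k + 1) → NoRepeat c (p k) (p (k + 1))

/-- The inequality on the second norm of a block is strict for every block. -/
def StrictBlocks {M N : ℕ} (b : Fin N → ℝ) (lam : Fin M → ℝ) (p : ℕ → ℕ) : Prop :=
  ∀ k, 1 ≤ k → k < M → partialSqSum b (p k) < partialSum lam k →
    partialSum lam k - partialSqSum b (p k) < seqAt b (p k + 1) ^ 2

/-- Vectors with the same label are orthogonal. -/
def OrthogonalLabels {M N K : ℕ} (f : Fin N → Eucl M) (c : Fin N → Fin K) : Prop :=
  ∀ i j : Fin N, i ≠ j → c i = c j → inner ℝ (f i) (f j) = 0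

/-- The index set of the weights, the `k`-th repeated `d k` times: `⟨k, j⟩` stands for `a_{k,j}`.
-/
abbrev Copies {K : ℕ} (d : Fin K → ℕ) : Type := Σ k : Fin K, Fin (d k)

end SpectralTetris

end

noncomputable section

namespace SpectralTetris

/-! ### Partial sums, the 2 × 2 block and the loop invariant. -/

section

/-! Think of the output as an `M × N` matrix. Readiness makes its rows orthogonal with squared norms
`lam`, so the frame operator is diagonal; each column is a multiple of some `e k` or one of the two
columns of a block (`exists_isOutput`). The columns meeting row `k` all lie in the window of
(A)–(B). Hence under the window conditions equal labels never share a row and are orthogonal. If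
every block inequality is strict, the window is exactly the support of the row, and the converse
follows.

Orthogonality gives the fusion frame: copies of `a k` are orthogonal vectors of length `a k`, so
their frame operator is `a k ^ 2` times the projection onto their span.

The hard direction starts from an arbitrary spectral tetris fusion frame, whose norms need not be
the weights. For each label the partial frame operator is `a k ^ 2` times a projection, and it is
tridiagonal because a column meets at most two adjacent rows. Such a matrix splits into diagonal
entries `0` or `a k ^ 2` and rank one 2 × 2 blocks of trace `a k ^ 2`. An off-diagonal entry can
only come from a block of the construction, whose two contributions are opposite; so it is present
for no label or for exactly two, and then the two columns already have the right weights as norms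
(`exists_block_labels`). Keeping these blocks and replacing everything else by singletons yields a
new ordering (`exists_ready_of_labelGram`). In each row every label has just one role, which is the
window condition. -/

/-- What remains of the first `k` eigenvalues after the columns before `p k`. -/
def residue {M N : ℕ} (b : Fin N → ℝ) (lam : Fin M → ℝ) (p : ℕ → ℕ) (k : ℕ) : ℝ :=
  partialSum lam k - partialSqSum b (p k)

/-- The shape of a `2 × 2` block in the rows `j`, `j + 1`, with row sum `x` in row `j`. -/
def IsBlock (j : ℕ) (b₁ b₂ x : ℝ) (u v : ℕ → ℝ) : Prop :=
  ∃ α β γ δ : ℝ, u = α • e j + β • e (j + 1) ∧ v = γ • e j - δ • e (j + 1) ∧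
    0 ≤ α ∧ 0 < β ∧ 0 < γ ∧ 0 ≤ δ ∧ α * β = γ * δ ∧ α ^ 2 + β ^ 2 = b₁ ^ 2 ∧
    γ ^ 2 + δ ^ 2 = b₂ ^ 2 ∧ α ^ 2 + γ ^ 2 = x ∧ (x < b₂ ^ 2 → 0 < α)

/-- The vectors `v` are those written by the construction. -/
structure IsOutput {M N : ℕ} (b : Fin N → ℝ) (lam : Fin M → ℝ) (p : ℕ → ℕ)
    (v : ℕ → ℕ → ℝ) : Prop where
  single : ∀ k, k < M → ∀ n, p k ≤ n → n < p (k + 1) →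
    (residue b lam p k = 0 ∨ p k + 2 ≤ n) → v n = seqAt b n • e k
  block : ∀ j, j + 1 < M → 0 < residue b lam p (j + 1) →
    IsBlock j (seqAt b (p (j + 1))) (seqAt b (p (j + 1) + 1)) (residue b lam p (j + 1))
      (v (p (j + 1))) (v (p (j + 1) + 1))
  gram : ∀ i j, ∑ n ∈ Finset.range N, v n i * v n j = if i = j then seqAt lam i else 0

lemma seqAt_of_lt {N : ℕ} (b : Fin N → ℝ) {n : ℕ} (h : n < N) : seqAt b n = b ⟨n, h⟩ := by
  simp [seqAt, h]

lemma seqAt_of_le {N : ℕ} (b : Fin N → ℝ) {n : ℕ} (h : N ≤ n) : seqAt b n = 0 := by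
  simp [seqAt, h]

lemma sum_range_seqAt {N : ℕ} (b : Fin N → ℝ) :
    ∑ n ∈ Finset.range N, seqAt b n = ∑ n, b n := by
  rw [Finset.sum_range]
  exact Finset.sum_congr rfl fun n _ => seqAt_of_lt b n.2

lemma partialSum_succ {M : ℕ} (lam : Fin M → ℝ) (k : ℕ) :
    partialSum lam (k + 1) = partialSum lam k + seqAt lam k := Finset.sum_range_succ _ _

lemma partialSqSum_succ {N : ℕ} (b : Fin N → ℝ) (n : ℕ) :
    partialSqSum b (n + 1) = partialSqSum b n + seqAt b n ^ 2 := Finset.sum_range_succ _ _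

lemma partialSqSum_mono {N : ℕ} (b : Fin N → ℝ) : Monotone (partialSqSum b) :=
  monotone_nat_of_le_succ fun n => by
    rw [partialSqSum_succ]; nlinarith [sq_nonneg (seqAt b n)]

@[simp] lemma partialSum_zero {M : ℕ} (lam : Fin M → ℝ) : partialSum lam 0 = 0 := by
  simp [partialSum]

@[simp] lemma partialSqSum_zero {N : ℕ} (b : Fin N → ℝ) : partialSqSum b 0 = 0 := by
  simp [partialSqSum]

/-- The algebra of a block whose row sum `x` is less than `b₁²` and at most `b₂²`. -/
lemma isBlock_sqrt (j : ℕ) {b₁ b₂ x y : ℝ} (hx : 0 < x) (h₁ : x < b₁ ^ 2) (h₂ : x ≤ b₂ ^ 2)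
    (hy : y = b₁ ^ 2 + b₂ ^ 2 - x) :
    IsBlock j b₁ b₂ x
      (√(x * (b₁ ^ 2 - y) / (x - y)) • e j + √(y * (x - b₁ ^ 2) / (x - y)) • e (j + 1))
      (√(x * (x - b₁ ^ 2) / (x - y)) • e j - √(y * (b₁ ^ 2 - y) / (x - y)) • e (j + 1)) := by
  have hy0 : b₁ ^ 2 ≤ y := by linarith
  have hxy : 0 < y - x := by linarith
  have hne : x - y ≠ 0 := by linarith
  -- Here `x < y`, so numerators and denominators of the radicands are nonpositive; changing both
  -- signs makes the radicands visibly nonnegative.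
  have flip : ∀ z w : ℝ, z * w / (x - y) = z * (-w) / (y - x) := fun z w => by
    rw [← neg_div_neg_eq]; congr 1 <;> ring
  have e1 : x * (b₁ ^ 2 - y) / (x - y) = x * (y - b₁ ^ 2) / (y - x) := by rw [flip, neg_sub]
  have e2 : y * (x - b₁ ^ 2) / (x - y) = y * (b₁ ^ 2 - x) / (y - x) := by rw [flip, neg_sub]
  have e3 : x * (x - b₁ ^ 2) / (x - y) = x * (b₁ ^ 2 - x) / (y - x) := by rw [flip, neg_sub]
  have e4 : y * (b₁ ^ 2 - y) / (x - y) = y * (y - b₁ ^ 2) / (y - x) := by rw [flip, neg_sub]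
  have p1 : 0 ≤ x * (y - b₁ ^ 2) / (y - x) :=
    div_nonneg (mul_nonneg hx.le (by linarith)) hxy.le
  have p2 : 0 < y * (b₁ ^ 2 - x) / (y - x) :=
    div_pos (mul_pos (by linarith) (by linarith)) hxy
  have p3 : 0 < x * (b₁ ^ 2 - x) / (y - x) := div_pos (mul_pos hx (by linarith)) hxy
  have p4 : 0 ≤ y * (y - b₁ ^ 2) / (y - x) :=
    div_nonneg (mul_nonneg (by linarith) (by linarith)) hxy.le
  have hne' : y - x ≠ 0 := hxy.ne'
  rw [e1, e2, e3, e4]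
  refine ⟨_, _, _, _, rfl, rfl, Real.sqrt_nonneg _, Real.sqrt_pos.2 p2, Real.sqrt_pos.2 p3,
    Real.sqrt_nonneg _, ?_, ?_, ?_, ?_, ?_⟩
  · rw [← Real.sqrt_mul p1, ← Real.sqrt_mul p3.le]
    congr 1; ring
  · rw [Real.sq_sqrt p1, Real.sq_sqrt p2.le]; field_simp; ring
  · rw [Real.sq_sqrt p3.le, Real.sq_sqrt p4, ← add_div, div_eq_iff hne', hy]; ring
  · rw [Real.sq_sqrt p1, Real.sq_sqrt p3.le]; field_simp; ring
  · intro h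
    exact Real.sqrt_pos.2 (div_pos (mul_pos hx (by linarith)) hxy)

/-- The identity `α * β = γ * δ` cancels the cross terms: a block fills row `j` with `x`, puts the
remaining mass in row `j + 1`, and keeps the two rows orthogonal. -/
lemma IsBlock.gram {j : ℕ} {b₁ b₂ x : ℝ} {u v : ℕ → ℝ} (h : IsBlock j b₁ b₂ x u v) (i l : ℕ) :
    u i * u l + v i * v l = if i = l then
      (if i = j then x else if i = j + 1 then b₁ ^ 2 + b₂ ^ 2 - x else 0) else 0 := by
  obtain ⟨α, β, γ, δ, rfl, rfl, -, -, -, -, h1, h2, h3, h4, -⟩ := h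
  simp only [e, Pi.add_apply, Pi.sub_apply, Pi.smul_apply, Pi.single_apply, smul_eq_mul]
  split_ifs <;> first | omega | (subst_vars; first | omega | nlinarith)

variable {M N : ℕ} {b : Fin N → ℝ} {lam : Fin M → ℝ} {p : ℕ → ℕ}

namespace IsReady

lemma monoOn (h : IsReady b lam p) {j k : ℕ} (hjk : j ≤ k) (hk : k ≤ M) : p j ≤ p k := by
  induction k, hjk using Nat.le_induction with
  | base => exact le_rfl
  | succ k _ ih => exact (ih (by omega)).trans (h.strict k (by omega)).le

lemma le_N (h : IsReady b lam p) {k : ℕ} (hk : k ≤ M) : p k ≤ N :=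
  h.last ▸ h.monoOn hk le_rfl

lemma exists_segment (h : IsReady b lam p) {n : ℕ} (hn : n < N) :
    ∃ k, k < M ∧ p k ≤ n ∧ n < p (k + 1) := by
  have key : ∀ k, k ≤ M → n < p k → ∃ k, k < M ∧ p k ≤ n ∧ n < p (k + 1) := by
    intro k
    induction k with
    | zero => intro _ h0; rw [h.start] at h0; omega
    | succ k ih =>
      intro hk hlt
      by_cases h' : n < p k
      · exact ih (by omega) h'
      · exact ⟨k, by omega, by omega, hlt⟩
  exact key M le_rfl (h.last ▸ hn)

lemma seqAt_pos (h : IsReady b lam p) {n : ℕ} (hn : n < N) : 0 < seqAt b n := by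
  rw [seqAt_of_lt b hn]; exact h.norms_pos _

lemma partialSqSum_N (h : IsReady b lam p) : partialSqSum b N = partialSum lam M := by
  have h1 : partialSqSum b N = ∑ n, b n ^ 2 := by
    rw [partialSqSum, Finset.sum_range]
    exact Finset.sum_congr rfl fun n _ => by rw [seqAt_of_lt b n.2]
  rw [h1, h.total, partialSum, sum_range_seqAt]

lemma residue_zero (h : IsReady b lam p) : residue b lam p 0 = 0 := by
  simp [residue, h.start]

lemma residue_last (h : IsReady b lam p) : residue b lam p M = 0 := by
  simp [residue, h.last, h.partialSqSum_N]

lemma residue_nonneg (h : IsReady b lam p) {k : ℕ} (hk : k ≤ M) : 0 ≤ residue b lam p k := by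
  rcases Nat.eq_zero_or_pos k with rfl | h0
  · exact h.residue_zero.ge
  rcases hk.eq_or_lt with rfl | h1
  · exact h.residue_last.ge
  · exact sub_nonneg.2 (h.cut k h0 h1).1

lemma residue_lt (h : IsReady b lam p) {k : ℕ} (h0 : 1 ≤ k) (hk : k < M) :
    residue b lam p k < seqAt b (p k) ^ 2 := by
  have := (h.cut k h0 hk).2
  rw [partialSqSum_succ] at this
  rw [residue]; linarith

lemma block' (h : IsReady b lam p) {k : ℕ} (h0 : 1 ≤ k) (hk : k < M)
    (hr : 0 < residue b lam p k) :
    p k + 2 ≤ p (k + 1) ∧ residue b lam p k ≤ seqAt b (p k + 1) ^ 2 :=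
  h.block k h0 hk (sub_pos.1 hr)

end IsReady

/-- The invariant of the loop. -/
structure Invariant (b : Fin N → ℝ) (lam : Fin M → ℝ) (p : ℕ → ℕ) (s : State) : Prop where
  row_lt : s.row < M
  le_col : p s.row ≤ s.col
  col_le : s.col ≤ p (s.row + 1)
  after_block : residue b lam p s.row = 0 ∨ p s.row + 2 ≤ s.col
  lam_row : s.lam s.row = partialSum lam (s.row + 1) - partialSqSum b s.col
  lam_gt : ∀ i, s.row < i → s.lam i = seqAt lam i
  lam_lt : ∀ i, i < s.row → s.lam i = 0
  gram : ∀ i j, ∑ n ∈ Finset.range s.col, s.vec n i * s.vec n j =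
    if i = j then seqAt lam i - s.lam i else 0
  single : ∀ k, k ≤ s.row → ∀ n, n < s.col → p k ≤ n → n < p (k + 1) →
    (residue b lam p k = 0 ∨ p k + 2 ≤ n) → s.vec n = seqAt b n • e k
  block : ∀ j, j + 1 ≤ s.row → 0 < residue b lam p (j + 1) →
    IsBlock j (seqAt b (p (j + 1))) (seqAt b (p (j + 1) + 1)) (residue b lam p (j + 1))
      (s.vec (p (j + 1))) (s.vec (p (j + 1) + 1))

end

/-! ### Correctness and termination of the construction. -/

section

variable {M N : ℕ} {b : Fin N → ℝ} {lam : Fin M → ℝ} {p : ℕ → ℕ}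

lemma invariant_init (h : IsReady b lam p) (hM : 0 < M) :
    Invariant b lam p { row := 0, col := 0, lam := seqAt lam, vec := fun _ _ => 0 } where
  row_lt := hM
  le_col := h.start.le
  col_le := Nat.zero_le _
  after_block := Or.inl h.residue_zero
  lam_row := by simp [partialSum_succ]
  lam_gt := fun _ _ => rfl
  lam_lt := fun i hi => absurd hi (Nat.not_lt_zero i)
  gram := fun i j => by simp
  single := fun _ _ n hn => absurd hn (Nat.not_lt_zero n)
  block := fun j hj => absurd hj (Nat.not_succ_le_zero j)

lemma sum_range_update_of_le {w : ℕ → ℕ → ℝ} {c n : ℕ} (hc : c ≤ n) (u : ℕ → ℝ) (i j : ℕ) :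
    ∑ m ∈ Finset.range c, Function.update w n u m i * Function.update w n u m j =
      ∑ m ∈ Finset.range c, w m i * w m j :=
  Finset.sum_congr rfl fun m hm => by
    rw [Function.update_of_ne (by have := Finset.mem_range.1 hm; omega)]

namespace Invariant

variable {s : State}

lemma step_skip (h : IsReady b lam p) (hs : Invariant b lam p s) (hN : s.col < N)
    (hcol : s.col = p (s.row + 1)) (hx : s.lam s.row = 0) :
    Invariant b lam p { s with row := s.row + 1 } := by
  have hrow : s.row + 1 < M := by
    rcases (show s.row + 1 ≤ M from hs.row_lt).eq_or_lt with h' | h'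
    · rw [hcol, h', h.last] at hN; omega
    · exact h'
  have hr : residue b lam p (s.row + 1) = 0 := by rw [residue, ← hcol, ← hs.lam_row, hx]
  refine ⟨hrow, hcol.ge, ?_, Or.inl hr, ?_, ?_, ?_, hs.gram, ?_, ?_⟩
  · exact hcol.le.trans (h.strict _ hrow).le
  · have h1 := hs.lam_row
    have h2 := hs.lam_gt (s.row + 1) (Nat.lt_succ_self _)
    simp only
    rw [h2, partialSum_succ lam (s.row + 1)]
    linarith
  · intro i hi
    exact hs.lam_gt i (by simp only at hi; omega)
  · intro i hi
    rcases (show i ≤ s.row by simp only at hi; omega).eq_or_lt with rfl | h'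
    · exact hx
    · exact hs.lam_lt i h'
  · intro k hk n hn h1 h2 h3
    rcases (show k ≤ s.row + 1 from hk).eq_or_lt with rfl | h'
    · simp only at hn; omega
    · exact hs.single k (by omega) n hn h1 h2 h3
  · intro j hj hj'
    rcases (show j + 1 ≤ s.row + 1 from hj).eq_or_lt with h' | h'
    · rw [h', hr] at hj'; exact absurd hj' (lt_irrefl _)
    · exact hs.block j (by omega) hj'

lemma step_single (h : IsReady b lam p) (hs : Invariant b lam p s)
    (hcol : s.col < p (s.row + 1)) :
    Invariant b lam p
      { row := s.row
        col := s.col + 1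
        lam := Function.update s.lam s.row (s.lam s.row - seqAt b s.col ^ 2)
        vec := Function.update s.vec s.col (seqAt b s.col • e s.row) } := by
  refine ⟨hs.row_lt, hs.le_col.trans (Nat.le_succ _), hcol, ?_, ?_, ?_, ?_, ?_, ?_, ?_⟩
  · exact hs.after_block.imp_right fun h => h.trans (Nat.le_succ _)
  · simp only [Function.update_self]
    rw [hs.lam_row, partialSqSum_succ]; ring
  · intro i hi
    simp only at hi ⊢
    rw [Function.update_of_ne hi.ne', hs.lam_gt i hi]
  · intro i hi
    simp only at hi ⊢
    rw [Function.update_of_ne hi.ne, hs.lam_lt i hi]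
  · intro i j
    simp only
    rw [Finset.sum_range_succ, sum_range_update_of_le le_rfl, hs.gram]
    simp only [Function.update_self, Pi.smul_apply, smul_eq_mul, e, Pi.single_apply,
      Function.update_apply]
    split_ifs <;> first | omega | (subst_vars; first | omega | ring)
  · intro k hk n hn h1 h2 h3
    simp only at hk hn ⊢
    rcases (show n ≤ s.col by omega).eq_or_lt with rfl | h'
    · have hk' : k = s.row := by
        by_contra hne
        have h4 : p (k + 1) ≤ p s.row := h.monoOn (by omega) hs.row_lt.le
        have := hs.le_col
        omega
      rw [Function.update_self, hk']
    · rw [Function.update_of_ne h'.ne]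
      exact hs.single k hk n h' h1 h2 h3
  · intro j hj hj'
    simp only at hj ⊢
    -- Both columns of an earlier block lie before the cursor, so the new singleton does not
    -- overwrite them.
    have h4 : p (j + 1) + 2 ≤ s.col := by
      have hM := hs.row_lt
      rcases hj.eq_or_lt with h' | h'
      · rw [h'] at hj' ⊢
        exact hs.after_block.resolve_left hj'.ne'
      · have h5 := (h.block' (k := j + 1) (by omega) (by omega) hj').1
        have h6 : p (j + 1 + 1) ≤ p s.row := h.monoOn (by omega) (by omega)
        have := hs.le_col
        omega
    rw [Function.update_of_ne (by omega), Function.update_of_ne (by omega)]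
    exact hs.block j hj hj'

lemma step_block (h : IsReady b lam p) (hs : Invariant b lam p s)
    (hcol : s.col = p (s.row + 1)) (hrow : s.row + 1 < M)
    (hr : 0 < residue b lam p (s.row + 1)) {u v : ℕ → ℝ}
    (huv : IsBlock s.row (seqAt b s.col) (seqAt b (s.col + 1)) (s.lam s.row) u v) :
    Invariant b lam p
      { row := s.row + 1
        col := s.col + 2
        lam := Function.update (Function.update s.lam (s.row + 1)
          (s.lam (s.row + 1) - (seqAt b s.col ^ 2 + seqAt b (s.col + 1) ^ 2 - s.lam s.row)))
          s.row 0
        vec := Function.update (Function.update s.vec s.col u) (s.col + 1) v } := by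
  have hres : s.lam s.row = residue b lam p (s.row + 1) := by
    rw [residue, ← hcol, ← hs.lam_row]
  obtain ⟨hb1, hb2⟩ := h.block' (k := s.row + 1) (by omega) hrow hr
  have hvec : ∀ n, n < s.col →
      Function.update (Function.update s.vec s.col u) (s.col + 1) v n = s.vec n := fun n hn => by
    rw [Function.update_of_ne (by omega), Function.update_of_ne (by omega)]
  have hu : Function.update (Function.update s.vec s.col u) (s.col + 1) v s.col = u := by
    rw [Function.update_of_ne (by omega), Function.update_self]
  refine ⟨hrow, ?_, ?_, ?_, ?_, ?_, ?_, ?_, ?_, ?_⟩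
  · simp only; omega
  · simp only; omega
  · simp only; omega
  · simp only
    rw [Function.update_of_ne (by omega), Function.update_self, partialSum_succ lam (s.row + 1),
      partialSqSum_succ, partialSqSum_succ, hs.lam_row, hs.lam_gt _ (Nat.lt_succ_self _)]
    ring
  · intro i hi
    simp only at hi ⊢
    rw [Function.update_of_ne (by omega), Function.update_of_ne (by omega),
      hs.lam_gt i (by omega)]
  · intro i hi
    simp only at hi ⊢
    rcases (show i ≤ s.row by omega).eq_or_lt with rfl | h'
    · rw [Function.update_self]
    · rw [Function.update_of_ne (by omega), Function.update_of_ne (by omega), hs.lam_lt i h']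
  · intro i j
    simp only
    rw [Finset.sum_range_succ, Finset.sum_range_succ, sum_range_update_of_le (by omega),
      sum_range_update_of_le le_rfl, hs.gram, hu, Function.update_self, add_assoc, huv.gram]
    simp only [Function.update_apply]
    split_ifs <;> first | omega | (subst_vars; first | omega | ring)
  · intro k hk n hn h1 h2 h3
    simp only at hk hn ⊢
    by_cases h' : n < s.col
    · rw [hvec n h']
      rcases hk.eq_or_lt with rfl | hk'
      · omega
      · exact hs.single k (by omega) n h' h1 h2 h3
    -- The two new columns are the first two of segment `row + 1`, whose positive residue excludes
    -- them from the singletons.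
    · exfalso
      rcases hk.eq_or_lt with rfl | hk'
      · rcases h3 with h3 | h3
        · exact hr.ne' h3
        · omega
      · have : p (k + 1) ≤ p (s.row + 1) := h.monoOn (by omega) hrow.le
        omega
  · intro j hj hj'
    simp only at hj ⊢
    rcases hj.eq_or_lt with h' | h'
    · have hj2 : j = s.row := by omega
      subst hj2
      rw [← hcol, hu, Function.update_self, ← hres]
      exact huv
    · have h5 := (h.block' (k := j + 1) (by omega) (by omega) hj').1
      have h6 : p (j + 1 + 1) ≤ p (s.row + 1) := h.monoOn (by omega) (by omega)
      rw [hvec _ (by omega), hvec _ (by omega)]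
      exact hs.block j (by omega) hj'

/-- The partition predicts the branch. Before column `p (row + 1)` the nonnegative residue leaves
room for a singleton. At that column the current variable equals the residue: if zero, the row
changes; if positive, it is less than the next squared norm and a block is written. Each branch
increases `row + col`. -/
lemma step (h : IsReady b lam p) (hs : Invariant b lam p s) (hN : s.col < N) :
    Invariant b lam p (step M N (seqAt b) s) ∧
      s.row + s.col < (SpectralTetris.step M N (seqAt b) s).row +
        (SpectralTetris.step M N (seqAt b) s).col := by
  have hrun : ¬ (N ≤ s.col ∨ M ≤ s.row) := by have := hs.row_lt; omega
  rcases hs.col_le.lt_or_eq with hcol | hcol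
  · have hx : seqAt b s.col ^ 2 ≤ s.lam s.row := by
      have h1 : partialSqSum b (s.col + 1) ≤ partialSqSum b (p (s.row + 1)) :=
        partialSqSum_mono b hcol
      have h2 := h.residue_nonneg (k := s.row + 1) hs.row_lt
      rw [partialSqSum_succ] at h1
      rw [residue] at h2
      rw [hs.lam_row]; linarith
    have hx0 : s.lam s.row ≠ 0 := by
      have := h.seqAt_pos hN; nlinarith [pow_pos this 2]
    rw [SpectralTetris.step]
    simp only [if_neg hrun, if_neg hx0, if_pos hx]
    exact ⟨hs.step_single h hcol, by simp⟩
  · by_cases hx0 : s.lam s.row = 0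
    · rw [SpectralTetris.step]
      simp only [if_neg hrun, if_pos hx0]
      exact ⟨hs.step_skip h hN hcol hx0, by simp⟩
    · have hrow : s.row + 1 < M := by
        rcases (show s.row + 1 ≤ M from hs.row_lt).eq_or_lt with h' | h'
        · rw [hcol, h', h.last] at hN; omega
        · exact h'
      have hres : s.lam s.row = residue b lam p (s.row + 1) := by
        rw [residue, ← hcol, ← hs.lam_row]
      have hr : 0 < residue b lam p (s.row + 1) :=
        (h.residue_nonneg hrow.le).lt_of_ne (by rw [← hres]; exact Ne.symm hx0)
      have hlt := h.residue_lt (k := s.row + 1) (by omega) hrow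
      have hle := (h.block' (k := s.row + 1) (by omega) hrow hr).2
      rw [← hres, ← hcol] at hlt hle
      have hx1 : ¬ seqAt b s.col ^ 2 ≤ s.lam s.row := not_le.2 hlt
      -- The case `x = y` of the construction cannot occur, since `x < b₁ ^ 2` and `x ≤ b₂ ^ 2`.
      have hx2 : ¬ 2 * s.lam s.row = seqAt b s.col ^ 2 + seqAt b (s.col + 1) ^ 2 := by
        intro h'; linarith
      rw [SpectralTetris.step]
      simp only [if_neg hrun, if_neg hx0, if_neg hx1, if_neg hx2]
      exact ⟨hs.step_block h hcol hrow hr (isBlock_sqrt _ (hres ▸ hr) hlt hle rfl),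
        by omega⟩

end Invariant

/-- The construction applied to ready sequences. -/
theorem exists_isOutput (h : IsReady b lam p) :
    ∃ v : ℕ → ℕ → ℝ, IsOutput b lam p v ∧ ∀ (n : Fin N) (m : Fin M), stc b lam n m = v n m := by
  rcases Nat.eq_zero_or_pos M with rfl | hM
  · refine ⟨fun _ _ => 0, ⟨fun k hk => absurd hk (Nat.not_lt_zero k),
      fun j hj => absurd hj (by omega), fun i j => ?_⟩, fun n m => m.elim0⟩
    simp [seqAt_of_le lam (Nat.zero_le i)]
  set s₀ : State := { row := 0, col := 0, lam := seqAt lam, vec := fun _ _ => 0 }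
  set t : ℕ → State := fun i => (step M N (seqAt b))^[i] s₀ with ht
  -- After `M + N` steps the second alternative and `row < M` would force `col > N`, so in either
  -- case all columns are written.
  have key : ∀ i, Invariant b lam p (t i) ∧ (N ≤ (t i).col ∨ i ≤ (t i).row + (t i).col) := by
    intro i
    induction i with
    | zero => exact ⟨invariant_init h hM, Or.inr (Nat.zero_le _)⟩
    | succ i ih =>
      have hsucc : t (i + 1) = step M N (seqAt b) (t i) := by
        simp only [ht, Function.iterate_succ_apply']
      rw [hsucc]
      by_cases hN : (t i).col < N
      · obtain ⟨h1, h2⟩ := ih.1.step h hN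
        exact ⟨h1, Or.inr (by omega)⟩
      · have : step M N (seqAt b) (t i) = t i := by
          rw [step]; simp only [if_pos (Or.inl (not_lt.1 hN))]
        rw [this]
        exact ⟨ih.1, Or.inl (not_lt.1 hN)⟩
  obtain ⟨hs, hend⟩ := key (M + N)
  have hle : (t (M + N)).col ≤ N := hs.col_le.trans (h.le_N hs.row_lt)
  have hcol : (t (M + N)).col = N := by have := hs.row_lt; omega
  have hrow : (t (M + N)).row + 1 = M := by
    by_contra hne
    have h1 := hs.row_lt
    have h2 : p ((t (M + N)).row + 1) < p ((t (M + N)).row + 1 + 1) := h.strict _ (by omega)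
    have h3 := h.le_N (k := (t (M + N)).row + 1 + 1) (by omega)
    have := hs.col_le
    omega
  refine ⟨(t (M + N)).vec, ⟨?_, ?_, ?_⟩, fun n m => rfl⟩
  · intro k hk n h1 h2 h3
    exact hs.single k (by omega) n (by rw [hcol]; exact h2.trans_le (h.le_N (by omega))) h1 h2 h3
  · intro j hj hj'
    exact hs.block j (by omega) hj'
  · intro i j
    have := hs.gram i j
    rw [hcol] at this
    rw [this]
    split_ifs with hij
    · rcases lt_trichotomy i (t (M + N)).row with h' | h' | h'
      · rw [hs.lam_lt i h', sub_zero]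
      · rw [h', hs.lam_row, hcol, hrow, h.partialSqSum_N]; ring
      · rw [hs.lam_gt i h', sub_self, seqAt_of_le lam (by omega)]
    · rfl

end

/-! ### Supports of rows, and windows against orthogonality. -/

section

variable {M N : ℕ} {b : Fin N → ℝ} {lam : Fin M → ℝ} {p : ℕ → ℕ} {v : ℕ → ℕ → ℝ}

lemma smul_e_apply (x : ℝ) (k i : ℕ) : (x • e k) i = if i = k then x else 0 := by
  simp [e, Pi.single_apply]

lemma smul_e_add_apply (x y : ℝ) (k i : ℕ) :
    (x • e k + y • e (k + 1)) i = if i = k then x else if i = k + 1 then y else 0 := by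
  simp only [Pi.add_apply, smul_e_apply]
  split_ifs <;> first | omega | ring

lemma smul_e_sub_apply (x y : ℝ) (k i : ℕ) :
    (x • e k - y • e (k + 1)) i = if i = k then x else if i = k + 1 then -y else 0 := by
  simp only [Pi.sub_apply, smul_e_apply]
  split_ifs <;> first | omega | ring

/-- The end of the range of columns in which the construction writes to row `k`. -/
def windowEnd (b : Fin N → ℝ) (lam : Fin M → ℝ) (p : ℕ → ℕ) (k : ℕ) : ℕ :=
  open Classical in if 0 < residue b lam p (k + 1) then p (k + 1) + 2 else p (k + 1)

/-- Only the residue at `k + 1` affects the range of a window; the distinction between (A) and (B)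
does not. -/
lemma windowConditions_iff {K : ℕ} (h : IsReady b lam p) (c : Fin N → Fin K) :
    WindowConditions b lam p c ↔ ∀ k, k < M → NoRepeat c (p k) (windowEnd b lam p k) := by
  constructor
  · intro hw k hk
    have h0 := h.residue_nonneg hk.le
    have h1 := h.residue_nonneg (k := k + 1) hk
    rw [windowEnd]
    rw [residue, sub_nonneg] at h0 h1
    split_ifs with hr
    · rw [residue, sub_pos] at hr
      rcases h0.lt_or_eq with h0 | h0
      · exact hw.Aa k hk h0 hr
      · exact hw.Ba k hk h0 hr
    · rw [residue, sub_pos, not_lt] at hr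
      rcases h0.lt_or_eq with h0 | h0
      · exact hw.Ab k hk h0 (h1.antisymm hr)
      · exact hw.Bb k hk h0 (h1.antisymm hr)
  · intro hw
    have hend : ∀ k, partialSqSum b (p (k + 1)) < partialSum lam (k + 1) →
        windowEnd b lam p k = p (k + 1) + 2 := fun k hk => if_pos (sub_pos.2 hk)
    have hend' : ∀ k, partialSqSum b (p (k + 1)) = partialSum lam (k + 1) →
        windowEnd b lam p k = p (k + 1) := fun k hk => if_neg (by simp [residue, hk])
    exact ⟨fun k hk _ h2 => hend k h2 ▸ hw k hk, fun k hk _ h2 => hend' k h2 ▸ hw k hk,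
      fun k hk _ h2 => hend k h2 ▸ hw k hk, fun k hk _ h2 => hend' k h2 ▸ hw k hk⟩

namespace IsOutput

lemma cases (h : IsReady b lam p) (ho : IsOutput b lam p v) {n : ℕ} (hn : n < N) :
    (∃ k, k < M ∧ p k ≤ n ∧ n < p (k + 1) ∧ (residue b lam p k = 0 ∨ p k + 2 ≤ n) ∧
      v n = seqAt b n • e k) ∨
    ∃ j, j + 1 < M ∧ 0 < residue b lam p (j + 1) ∧ (n = p (j + 1) ∨ n = p (j + 1) + 1) := by
  obtain ⟨k, hk, h1, h2⟩ := h.exists_segment hn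
  by_cases h3 : residue b lam p k = 0 ∨ p k + 2 ≤ n
  · exact Or.inl ⟨k, hk, h1, h2, h3, ho.single k hk n h1 h2 h3⟩
  · push Not at h3
    right
    rcases k with _ | j
    · exact absurd h.residue_zero h3.1
    · exact ⟨j, hk, (h.residue_nonneg hk.le).lt_of_ne h3.1.symm, by omega⟩

/-- A vector writes to two different rows only if it belongs to their block. -/
lemma adjacent (h : IsReady b lam p) (ho : IsOutput b lam p v) {n : ℕ} (hn : n < N) {i l : ℕ}
    (hi : v n i ≠ 0) (hl : v n l ≠ 0) (hil : i < l) :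
    l = i + 1 ∧ l < M ∧ 0 < residue b lam p l ∧ (n = p l ∨ n = p l + 1) := by
  rcases ho.cases h hn with ⟨k, -, -, -, -, hv⟩ | ⟨j, hj, hr, hnj⟩
  · rw [hv, smul_e_apply] at hi hl
    simp only [ne_eq, ite_eq_right_iff, Classical.not_imp] at hi hl
    omega
  · obtain ⟨α, β, γ, δ, hu, hv, -⟩ := ho.block j hj hr
    have : ∀ m, v n m ≠ 0 → m = j ∨ m = j + 1 := by
      intro m hm
      by_contra hne
      push Not at hne
      rcases hnj with rfl | rfl
      · rw [hu, smul_e_add_apply, if_neg hne.1, if_neg hne.2] at hm; exact hm rfl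
      · rw [hv, smul_e_sub_apply, if_neg hne.1, if_neg hne.2] at hm; exact hm rfl
    have h1 := this i hi
    have h2 := this l hl
    obtain rfl : i = j := by omega
    obtain rfl : l = i + 1 := by omega
    exact ⟨rfl, hj, hr, hnj⟩

/-- A block placed at `p (j + 1)` still meets row `j`, hence the two extra columns at the end of a
window. -/
lemma mem_window (h : IsReady b lam p) (ho : IsOutput b lam p v) {n : ℕ} (hn : n < N) {m : ℕ}
    (hm : v n m ≠ 0) : m < M ∧ p m ≤ n ∧ n < windowEnd b lam p m := by
  have hend : ∀ k, p (k + 1) ≤ windowEnd b lam p k := fun k => by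
    rw [windowEnd]; split_ifs <;> omega
  rcases ho.cases h hn with ⟨k, hk, h1, h2, -, hv⟩ | ⟨j, hj, hr, hnj⟩
  · rw [hv, smul_e_apply] at hm
    simp only [ne_eq, ite_eq_right_iff, Classical.not_imp] at hm
    obtain ⟨rfl, -⟩ := hm
    exact ⟨hk, h1, h2.trans_le (hend _)⟩
  · have hmj : m = j ∨ m = j + 1 := by
      obtain ⟨α, β, γ, δ, hu, hv, -⟩ := ho.block j hj hr
      by_contra hne
      push Not at hne
      rcases hnj with rfl | rfl
      · rw [hu, smul_e_add_apply, if_neg hne.1, if_neg hne.2] at hm; exact hm rfl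
      · rw [hv, smul_e_sub_apply, if_neg hne.1, if_neg hne.2] at hm; exact hm rfl
    have h1 := (h.block' (k := j + 1) (by omega) hj hr).1
    have h2 := h.strict j (by omega)
    rcases hmj with rfl | rfl
    · refine ⟨by omega, by omega, ?_⟩
      rw [windowEnd, if_pos hr]; omega
    · have := hend (j + 1)
      exact ⟨hj, by omega, by omega⟩

lemma sum_sq (h : IsReady b lam p) (ho : IsOutput b lam p v) {n : ℕ} (hn : n < N) :
    ∑ m : Fin M, v n m ^ 2 = seqAt b n ^ 2 := by
  rw [← Finset.sum_range (fun m => v n m ^ 2)]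
  rcases ho.cases h hn with ⟨k, hk, -, -, -, hv⟩ | ⟨j, hj, hr, hnj⟩
  · rw [Finset.sum_eq_single_of_mem k (Finset.mem_range.2 hk), hv, smul_e_apply, if_pos rfl]
    intro m _ hm
    rw [hv, smul_e_apply, if_neg hm]; ring
  · obtain ⟨α, β, γ, δ, hu, hv, -, -, -, -, -, h1, h2, -⟩ := ho.block j hj hr
    have hz : ∀ m, m ∉ ({j, j + 1} : Finset ℕ) → v n m = 0 := by
      intro m hne
      simp only [Finset.mem_insert, Finset.mem_singleton, not_or] at hne
      rcases hnj with rfl | rfl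
      · rw [hu, smul_e_add_apply, if_neg hne.1, if_neg hne.2]
      · rw [hv, smul_e_sub_apply, if_neg hne.1, if_neg hne.2]
    rw [← Finset.sum_subset (s₁ := {j, j + 1}), Finset.sum_pair (by omega)]
    · rcases hnj with rfl | rfl
      · rw [hu, smul_e_add_apply, smul_e_add_apply, ← h1]; simp
      · rw [hv, smul_e_sub_apply, smul_e_sub_apply, ← h2]; simp
    · intro m hm
      simp only [Finset.mem_insert, Finset.mem_singleton] at hm
      exact Finset.mem_range.2 (by omega)
    · intro m _ hm
      rw [hz m hm]; ring

/-- In a block only `α` and `δ` can vanish, and they do so together, since `α * β = γ * δ` with `β,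
γ > 0`. Strictness gives `α > 0`. -/
lemma apply_ne_zero (h : IsReady b lam p) (hs : StrictBlocks b lam p)
    (ho : IsOutput b lam p v) {n m : ℕ} (hm : m < M) (h1 : p m ≤ n)
    (h2 : n < windowEnd b lam p m) : v n m ≠ 0 := by
  have strict : ∀ j, j + 1 < M → 0 < residue b lam p (j + 1) →
      residue b lam p (j + 1) < seqAt b (p (j + 1) + 1) ^ 2 := fun j hj hr =>
    hs (j + 1) (by omega) hj (sub_pos.1 hr)
  by_cases h3 : n < p (m + 1)
  · by_cases h4 : residue b lam p m = 0 ∨ p m + 2 ≤ n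
    · rw [ho.single m hm n h1 h3 h4, smul_e_apply, if_pos rfl]
      exact (h.seqAt_pos (h3.trans_le (h.le_N (by omega)))).ne'
    · push Not at h4
      rcases m with _ | j
      · exact absurd h.residue_zero h4.1
      · have hr := (h.residue_nonneg hm.le).lt_of_ne h4.1.symm
        obtain ⟨α, β, γ, δ, hu, hv, hα, hβ, hγ, hδ, hαβ, -, -, -, hst⟩ := ho.block j hm hr
        have hα' := hst (strict j hm hr)
        have hδ' : 0 < δ := hδ.lt_of_ne fun h0 => by
          rw [← h0] at hαβ; nlinarith [mul_pos hα' hβ]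
        rcases (show n = p (j + 1) ∨ n = p (j + 1) + 1 by omega) with rfl | rfl
        · rw [hu, smul_e_add_apply, if_neg (by omega), if_pos rfl]; exact hβ.ne'
        · rw [hv, smul_e_sub_apply, if_neg (by omega), if_pos rfl]
          exact neg_ne_zero.2 hδ'.ne'
  · rw [windowEnd] at h2
    split_ifs at h2 with hr
    · have hm' : m + 1 < M := by
        rcases (show m + 1 ≤ M from hm).eq_or_lt with h' | h'
        · rw [h', h.residue_last] at hr; exact absurd hr (lt_irrefl _)
        · exact h'
      obtain ⟨α, β, γ, δ, hu, hv, hα, hβ, hγ, hδ, hαβ, -, -, -, hst⟩ := ho.block m hm' hr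
      rcases (show n = p (m + 1) ∨ n = p (m + 1) + 1 by omega) with rfl | rfl
      · rw [hu, smul_e_add_apply, if_pos rfl]; exact (hst (strict m hm' hr)).ne'
      · rw [hv, smul_e_sub_apply, if_pos rfl]; exact hγ.ne'
    · exact absurd h2 h3

end IsOutput

/-- The two vectors of a strict block are not orthogonal. -/
lemma IsBlock.sum_mul_ne_zero {j : ℕ} {b₁ b₂ x : ℝ} {u w : ℕ → ℝ} (hb : IsBlock j b₁ b₂ x u w)
    (h₂ : x < b₂ ^ 2) (hj : j + 1 < M) :
    ∑ m : Fin M, u m * w m ≠ 0 := by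
  obtain ⟨α, β, γ, δ, rfl, rfl, hα, hβ, hγ, hδ, hαβ, h1, h2, h3, hst⟩ := hb
  have hα' := hst h₂
  rw [← Finset.sum_range (fun m => (α • e j + β • e (j + 1)) m * (γ • e j - δ • e (j + 1)) m),
    ← Finset.sum_subset (s₁ := {j, j + 1}), Finset.sum_pair (by omega)]
  · simp only [smul_e_add_apply, smul_e_sub_apply, if_true, Nat.succ_ne_self, if_false]
    intro h0
    have h4 : α * γ = β * δ := by linarith
    have h5 : γ * (α ^ 2 - δ ^ 2) = 0 := by linear_combination α * h4 + δ * hαβ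
    have h6 : α * (γ ^ 2 - β ^ 2) = 0 := by linear_combination γ * h4 - β * hαβ
    rcases mul_eq_zero.1 h5 with h5 | h5
    · exact hγ.ne' h5
    rcases mul_eq_zero.1 h6 with h6 | h6
    · exact hα'.ne' h6
    linarith
  · intro m hm
    simp only [Finset.mem_insert, Finset.mem_singleton] at hm
    exact Finset.mem_range.2 (by omega)
  · intro m _ hm
    simp only [Finset.mem_insert, Finset.mem_singleton, not_or] at hm
    rw [smul_e_add_apply, if_neg hm.1, if_neg hm.2, zero_mul]

lemma inner_stc (hv : ∀ (n : Fin N) (m : Fin M), stc b lam n m = v n m) (i j : Fin N) :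
    inner ℝ (stc b lam i) (stc b lam j) = ∑ m : Fin M, v i m * v j m := by
  simp only [PiLp.inner_apply, hv, RCLike.inner_apply, conj_trivial]
  exact Finset.sum_congr rfl fun m _ => mul_comm _ _

theorem orthogonalLabels_of_windowConditions {K : ℕ} (h : IsReady b lam p) {c : Fin N → Fin K}
    (hw : WindowConditions b lam p c) : OrthogonalLabels (stc b lam) c := by
  obtain ⟨v, ho, hv⟩ := exists_isOutput h
  rw [windowConditions_iff h] at hw
  intro i j hij hc
  rw [inner_stc hv]
  refine Finset.sum_eq_zero fun m _ => ?_
  by_contra hne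
  obtain ⟨hi, hj⟩ := mul_ne_zero_iff.1 hne
  obtain ⟨-, h1, h2⟩ := ho.mem_window h i.2 hi
  obtain ⟨-, h3, h4⟩ := ho.mem_window h j.2 hj
  exact hw m m.2 i j h1 h2 h3 h4 hij hc

theorem windowConditions_of_orthogonalLabels {K : ℕ} (h : IsReady b lam p) {c : Fin N → Fin K}
    (hs : StrictBlocks b lam p) (hc : OrthogonalLabels (stc b lam) c) :
    WindowConditions b lam p c := by
  obtain ⟨v, ho, hv⟩ := exists_isOutput h
  rw [windowConditions_iff h]
  have key : ∀ k, k < M → ∀ i j : Fin N, i < j → p k ≤ i → i < windowEnd b lam p k →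
      p k ≤ j → j < windowEnd b lam p k → c i ≠ c j := by
    intro k hk i j hij h1 h2 h3 h4 hcij
    have hort := hc i j hij.ne hcij
    rw [inner_stc hv] at hort
    have hi := ho.apply_ne_zero h hs hk h1 h2
    have hj := ho.apply_ne_zero h hs hk h3 h4
    -- If both vectors also meet another row, they are the two columns of one block, which are not
    -- orthogonal when it is strict. Otherwise the inner product is the single nonzero term of row
    -- `k`.
    by_cases hblock : ∃ m : Fin M, (m : ℕ) ≠ k ∧ v i m * v j m ≠ 0
    · obtain ⟨m, hmk, hne⟩ := hblock
      obtain ⟨hi', hj'⟩ := mul_ne_zero_iff.1 hne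
      have hij' : (i : ℕ) < j := hij
      have hexists : ∃ l, l + 1 < M ∧ 0 < residue b lam p (l + 1) ∧ (i : ℕ) = p (l + 1) ∧
          (j : ℕ) = p (l + 1) + 1 := by
        rcases lt_or_gt_of_ne hmk with hlt | hlt
        · obtain ⟨e1, e2, e3, e4⟩ := ho.adjacent h i.2 hi' hi hlt
          obtain ⟨-, -, -, e5⟩ := ho.adjacent h j.2 hj' hj hlt
          rw [e1] at e2 e3 e4 e5
          exact ⟨m, e2, e3, by omega, by omega⟩
        · obtain ⟨e1, e2, e3, e4⟩ := ho.adjacent h i.2 hi hi' hlt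
          obtain ⟨-, -, -, e5⟩ := ho.adjacent h j.2 hj hj' hlt
          rw [e1] at e2 e3 e4 e5
          exact ⟨k, e2, e3, by omega, by omega⟩
      obtain ⟨l, hl, hr, e1, e2⟩ := hexists
      have hb := ho.block l hl hr
      rw [e1, e2] at hort
      exact hb.sum_mul_ne_zero
        (hs (l + 1) (by omega) hl (sub_pos.1 hr)) hl hort
    · push Not at hblock
      rw [Finset.sum_eq_single_of_mem (⟨k, hk⟩ : Fin M) (Finset.mem_univ _)] at hort
      · exact mul_ne_zero hi hj hort
      · intro m _ hm
        exact hblock m fun h' => hm (Fin.ext h')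
  intro k hk i j h1 h2 h3 h4 hij
  rcases lt_or_gt_of_ne hij with h' | h'
  · exact key k hk i j h' h1 h2 h3 h4
  · exact (key k hk j i h' h3 h4 h1 h2).symm

end

/-! ### From orthogonal labels to a fusion frame. -/

section

variable {M N K : ℕ}

lemma frameOperator_apply {ι : Type} [Fintype ι] (f : ι → Eucl M) (v : Eucl M) :
    frameOperator f v = ∑ n, inner ℝ (f n) v • f n := by
  simp [frameOperator]

lemma fusionFrameOperator_apply (W : Fin K → Submodule ℝ (Eucl M)) (ν : Fin K → ℝ)
    (v : Eucl M) :
    fusionFrameOperator W ν v = ∑ k, ν k ^ 2 • (W k).starProjection v := by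
  simp [fusionFrameOperator]

lemma inner_frameOperator {ι : Type} [Fintype ι] (f : ι → Eucl M) (v : Eucl M) :
    inner ℝ v (frameOperator f v) = ∑ n, (inner ℝ v (f n)) ^ 2 := by
  rw [frameOperator_apply, inner_sum]
  exact Finset.sum_congr rfl fun n _ => by
    rw [real_inner_smul_right, real_inner_comm, sq]

/-- The diagonal entries of a diagonal operator are its eigenvalues. -/
lemma hasEigenvalues_of_diagonal {S : Eucl M →L[ℝ] Eucl M} {lam : Fin M → ℝ}
    (hS : ∀ v i, S v i = lam i * v i) : HasEigenvalues S lam := by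
  have hm : LinearMap.toMatrix (EuclideanSpace.basisFun (Fin M) ℝ).toBasis
      (EuclideanSpace.basisFun (Fin M) ℝ).toBasis (S : Eucl M →ₗ[ℝ] Eucl M) =
      Matrix.diagonal lam := by
    ext i j
    simp [LinearMap.toMatrix_apply, hS, Matrix.diagonal_apply]
  rw [HasEigenvalues, ← LinearMap.charpoly_toMatrix _
    (EuclideanSpace.basisFun (Fin M) ℝ).toBasis, hm, Matrix.charpoly_diagonal,
    Polynomial.roots_prod _ _ (by simp [Finset.prod_ne_zero_iff, Polynomial.X_sub_C_ne_zero])]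
  simp

lemma card_fiber_eq_count {ι α : Type*} [Fintype ι] [DecidableEq α] (f : ι → α) (x : α)
    [Fintype {i // f i = x}] :
    Fintype.card {i // f i = x} = (Finset.univ.val.map f).count x := by
  rw [Multiset.count_map, Fintype.card_subtype]
  simp only [eq_comm, Finset.card, Finset.filter_val]

/-- Two families with the same multiset of values differ by a permutation. -/
lemma exists_perm_of_map_eq {ι α : Type*} [Fintype ι] {f g : ι → α}
    (h : Finset.univ.val.map f = Finset.univ.val.map g) :
    ∃ σ : Equiv.Perm ι, ∀ i, g (σ i) = f i := by
  classical
  exact ⟨Equiv.ofFiberEquiv fun x => Fintype.equivOfCardEq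
    (by rw [card_fiber_eq_count, card_fiber_eq_count, h]), Equiv.ofFiberEquiv_map _⟩

lemma hasEigenvalues_perm {S : Eucl M →L[ℝ] Eucl M} {lam : Fin M → ℝ} (σ : Equiv.Perm (Fin M)) :
    HasEigenvalues S (fun m => lam (σ m)) ↔ HasEigenvalues S lam := by
  have : Finset.univ.val.map (fun m => lam (σ m)) = Finset.univ.val.map lam := by
    have := Multiset.map_univ_val_equiv σ
    conv_rhs => rw [← this, Multiset.map_map]
    rfl
  rw [HasEigenvalues, HasEigenvalues, this]

section

variable {b : Fin N → ℝ} {lam : Fin M → ℝ} {p : ℕ → ℕ}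

lemma frameOperator_stc (h : IsReady b lam p) (v : Eucl M) (i : Fin M) :
    frameOperator (stc b lam) v i = lam i * v i := by
  obtain ⟨w, ho, hw⟩ := exists_isOutput h
  have h1 : frameOperator (stc b lam) v i =
      ∑ n : Fin N, ∑ m : Fin M, v m * (w n m * w n i) := by
    rw [frameOperator_apply, WithLp.ofLp_sum, Finset.sum_apply]
    refine Finset.sum_congr rfl fun n _ => ?_
    simp only [PiLp.smul_apply, smul_eq_mul, PiLp.inner_apply, RCLike.inner_apply, conj_trivial,
      hw, Finset.sum_mul]
    exact Finset.sum_congr rfl fun m _ => by ring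
  have h2 : ∀ m : Fin M, ∑ n : Fin N, w n m * w n i = if m = i then lam i else 0 := by
    intro m
    rw [← Finset.sum_range (fun n => w n m * w n i), ho.gram]
    simp only [Fin.val_inj]
    split_ifs with hmi
    · rw [hmi, seqAt_of_lt lam i.2]
    · rfl
  rw [h1, Finset.sum_comm]
  simp_rw [← Finset.mul_sum, h2]
  simp [mul_comm]

lemma inner_stc_self (h : IsReady b lam p) (n : Fin N) :
    inner ℝ (stc b lam n) (stc b lam n) = b n ^ 2 := by
  obtain ⟨w, ho, hw⟩ := exists_isOutput h
  rw [inner_stc hw]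
  simp_rw [← sq]
  rw [ho.sum_sq h n.2, seqAt_of_lt b n.2]

lemma isFrame_stc (h : IsReady b lam p) : IsFrame (stc b lam) := by
  obtain ⟨A, hA, hAlam⟩ : ∃ A : ℝ, 0 < A ∧ ∀ m, A ≤ lam m := by
    rcases isEmpty_or_nonempty (Fin M) with h' | h'
    · exact ⟨1, one_pos, fun m => h'.elim m⟩
    · obtain ⟨m, hm⟩ := Finite.exists_min lam
      exact ⟨lam m, h.eigenvalues_pos m, hm⟩
  have hsum : ∀ v : Eucl M, ∑ n, (inner ℝ v (stc b lam n)) ^ 2 = ∑ m, lam m * v m ^ 2 := by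
    intro v
    rw [← inner_frameOperator]
    simp only [PiLp.inner_apply, frameOperator_stc h, RCLike.inner_apply, conj_trivial]
    exact Finset.sum_congr rfl fun m _ => by ring
  -- Adding `A` to the sum ensures `A ≤ B` even in dimension zero.
  refine ⟨A, A + ∑ m, lam m, hA,
    le_add_of_nonneg_right (Finset.sum_nonneg fun m _ => (h.eigenvalues_pos m).le), fun v => ?_⟩
  rw [hsum, EuclideanSpace.real_norm_sq_eq, Finset.mul_sum, Finset.mul_sum]
  constructor
  · exact Finset.sum_le_sum fun m _ => mul_le_mul_of_nonneg_right (hAlam m) (sq_nonneg _)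
  · refine Finset.sum_le_sum fun m _ => mul_le_mul_of_nonneg_right ?_ (sq_nonneg _)
    have := Finset.single_le_sum (fun i _ => (h.eigenvalues_pos i).le) (Finset.mem_univ m)
    linarith

end

/-- The projection onto the span of an orthogonal family of vectors of the same length. -/
lemma smul_starProjection_span {ι : Type} [Fintype ι] {f : ι → Eucl M} {r : ℝ} (hr : r ≠ 0)
    (horth : ∀ i j, i ≠ j → inner ℝ (f i) (f j) = 0) (hnorm : ∀ i, inner ℝ (f i) (f i) = r)
    (v : Eucl M) :
    r • (Submodule.span ℝ (Set.range f)).starProjection v = frameOperator f v := by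
  rw [Submodule.eq_starProjection_of_mem_orthogonal (v := r⁻¹ • frameOperator f v),
    smul_inv_smul₀ hr]
  · rw [frameOperator_apply]
    exact Submodule.smul_mem _ _ (Submodule.sum_mem _ fun n _ =>
      Submodule.smul_mem _ _ (Submodule.subset_span (Set.mem_range_self n)))
  · rw [Submodule.mem_orthogonal]
    intro u hu
    induction hu using Submodule.span_induction with
    | mem x hx =>
      obtain ⟨i, rfl⟩ := hx
      rw [inner_sub_right, real_inner_smul_right, frameOperator_apply, inner_sum,
        Finset.sum_eq_single_of_mem i (Finset.mem_univ i)]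
      · rw [real_inner_smul_right, hnorm]; field_simp; ring
      · intro j _ hj
        rw [real_inner_smul_right, horth i j hj.symm, mul_zero]
    | zero => exact inner_zero_left _
    | add x y _ _ hx hy => rw [inner_add_left, hx, hy, add_zero]
    | smul t x _ hx => rw [real_inner_smul_left, hx, mul_zero]

lemma card_copies (d : Fin K → ℕ) {ι : Type} [Fintype ι] (σ : ι ≃ Copies d) (k : Fin K) :
    Fintype.card {n // (σ n).1 = k} = d k := by
  have e1 : {n // (σ n).1 = k} ≃ {x : Copies d // x.1 = k} :=
    σ.subtypeEquiv fun _ => Iff.rfl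
  have e2 : {x : Copies d // x.1 = k} ≃ Fin (d k) := Equiv.sigmaSubtype k
  rw [Fintype.card_congr (e1.trans e2), Fintype.card_fin]

/-- Take for `W k` the span of the copies of `a k`. Being orthogonal of length `a k`, they are
independent, which gives the dimension, and their frame operator is `a k ^ 2` times the projection;
summing over `k` gives the diagonal frame operator of the output. -/
theorem constructible_of_orthogonalLabels {a : Fin K → ℝ} {d : Fin K → ℕ} {lam : Fin M → ℝ}
    (ha : ∀ k, 0 < a k) (σ : Fin N ≃ Copies d) (σ' : Equiv.Perm (Fin M))
    {p : ℕ → ℕ} (h : IsReady (fun n => a (σ n).1) (fun m => lam (σ' m)) p)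
    (horth : OrthogonalLabels (stc (fun n => a (σ n).1) (fun m => lam (σ' m)))
      (fun n => (σ n).1)) : Constructible a d lam := by
  set f := stc (fun n => a (σ n).1) (fun m => lam (σ' m)) with hf
  set g : (k : Fin K) → {n // (σ n).1 = k} → Eucl M := fun k n => f n with hg
  set W : Fin K → Submodule ℝ (Eucl M) := fun k => Submodule.span ℝ (Set.range (g k)) with hW
  have hgorth : ∀ k i j, i ≠ j → inner ℝ (g k i) (g k j) = 0 := fun k i j hij =>
    horth i j (fun h' => hij (Subtype.ext h')) (i.2.trans j.2.symm)
  have hgnorm : ∀ k i, inner ℝ (g k i) (g k i) = a k ^ 2 := fun k i => by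
    have := inner_stc_self h i.1
    simp only [i.2] at this
    exact this
  have hproj : ∀ k v, a k ^ 2 • (W k).starProjection v = frameOperator (g k) v := fun k =>
    smul_starProjection_span (pow_ne_zero 2 (ha k).ne') (hgorth k) (hgnorm k)
  have hop : frameOperator f = fusionFrameOperator W a := by
    ext1 v
    rw [fusionFrameOperator_apply]
    simp_rw [hproj, frameOperator_apply]
    exact (Fintype.sum_fiberwise (fun n => (σ n).1) (fun n => inner ℝ (f n) v • f n)).symm
  refine ⟨W, fun k => ?_, ⟨⟨ha, ?_⟩, N, f, fun n => (σ n).1,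
    ⟨isFrame_stc h, _, _, p, h, rfl⟩, hop, fun k => ⟨pow_pos (ha k) 2, fun n =>
      Submodule.subset_span (Set.mem_range_self (f := g k) n), fun v hv => ?_⟩⟩, ?_⟩
  · rw [finrank_span_eq_card (linearIndependent_of_ne_zero_of_inner_eq_zero (fun i h0 => ?_)
      fun i j hij => hgorth k i j hij), card_copies d σ k]
    have := hgnorm k i
    rw [h0, inner_zero_left] at this
    exact (pow_pos (ha k) 2).ne this
  · obtain ⟨A, B, hA, hAB, hbd⟩ := isFrame_stc h
    refine ⟨A, B, hA, hAB, fun v => ?_⟩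
    have hmem : ∀ k v, (W k).starProjection v ∈ W k := fun k v => SetLike.coe_mem _
    -- Both sides are the quadratic form of the common operator, so the frame bounds carry over.
    have : ∑ k, a k ^ 2 * ‖(W k).starProjection v‖ ^ 2 = ∑ n, (inner ℝ v (f n)) ^ 2 := by
      rw [← inner_frameOperator, hop, fusionFrameOperator_apply, inner_sum]
      refine Finset.sum_congr rfl fun k _ => ?_
      rw [real_inner_smul_right, ← real_inner_self_eq_norm_sq,
        Submodule.inner_starProjection_left_eq_right, 
        Submodule.starProjection_eq_self_iff.2 (hmem k v)]
    rw [this]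
    exact hbd v
  · have := inner_frameOperator (g k) v
    rw [← hproj, Submodule.starProjection_eq_self_iff.2 hv, real_inner_smul_right,
      real_inner_self_eq_norm_sq] at this
    exact this.symm
  · rw [← hop, ← hasEigenvalues_perm σ']
    exact hasEigenvalues_of_diagonal (frameOperator_stc h)

end

/-! ### Ready sequences assembled from lists of labels. -/

section

variable {M N K : ℕ}

/-- The concatenation of the first `j` lists. -/
def concat {α : Type*} (L : ℕ → List α) : ℕ → List α
  | 0 => []
  | j + 1 => concat L j ++ L j

lemma concat_prefix {α : Type*} (L : ℕ → List α) {i j : ℕ} (h : i ≤ j) :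
    concat L i <+: concat L j := by
  induction j, h using Nat.le_induction with
  | base => exact List.prefix_rfl
  | succ j _ ih => exact ih.trans (List.prefix_append _ _)

lemma count_concat {α : Type*} [DecidableEq α] (L : ℕ → List α) (x : α) (j : ℕ) :
    (concat L j).count x = ∑ i ∈ Finset.range j, (L i).count x := by
  induction j with
  | zero => simp [concat]
  | succ j ih => rw [concat, List.count_append, ih, Finset.sum_range_succ]

lemma sum_map_concat {α : Type*} (L : ℕ → List α) (f : α → ℝ) (j : ℕ) :
    ((concat L j).map f).sum = ∑ i ∈ Finset.range j, ((L i).map f).sum := by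
  induction j with
  | zero => simp [concat]
  | succ j ih => rw [concat, List.map_append, List.sum_append, ih, Finset.sum_range_succ]

section

variable {ℓ : List (Fin K)} {c : Fin N → Fin K}

lemma seqAt_label (a : Fin K → ℝ) (hlen : ℓ.length = N)
    (hc : ∀ n : Fin N, ℓ[(n : ℕ)]? = some (c n)) (n : ℕ) :
    seqAt (fun n => a (c n)) n = ((ℓ[n]?).map a).getD 0 := by
  by_cases h : n < N
  · rw [seqAt_of_lt _ h, hc ⟨n, h⟩]; rfl
  · rw [seqAt_of_le _ (not_lt.1 h), List.getElem?_eq_none (by omega)]; rfl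

lemma partialSqSum_label (a : Fin K → ℝ) (hlen : ℓ.length = N)
    (hc : ∀ n : Fin N, ℓ[(n : ℕ)]? = some (c n)) (n : ℕ) :
    partialSqSum (fun n => a (c n)) n = ((ℓ.take n).map fun k => a k ^ 2).sum := by
  induction n with
  | zero => simp
  | succ n ih =>
    rw [partialSqSum_succ, ih, seqAt_label a hlen hc, List.take_add_one, List.map_append,
      List.sum_append]
    cases ℓ[n]? <;> simp

lemma noRepeat_of_nodup (hc : ∀ n : Fin N, ℓ[(n : ℕ)]? = some (c n)) {A X : List (Fin K)}
    (hℓ : A ++ X <+: ℓ) (hX : X.Nodup) : NoRepeat c A.length (A.length + X.length) := by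
  obtain ⟨C, rfl⟩ := hℓ
  have key : ∀ i : Fin N, A.length ≤ i → (i : ℕ) < A.length + X.length →
      X[(i : ℕ) - A.length]? = some (c i) := by
    intro i h1 h2
    rw [← hc i, List.getElem?_append_left (by simpa using h2), List.getElem?_append_right h1]
  intro i j hi1 hi2 hj1 hj2 hij hcij
  have h1 := key i hi1 hi2
  have h2 := key j hj1 hj2
  rw [← hcij, ← h1] at h2
  have := (List.getElem?_inj (by omega) hX).1 h2
  exact hij (Fin.ext (by omega))

end

/-- Labels in the rows `0, 1, …` determine ready sequences with the window conditions: `L m` lists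
the labels that start in row `m`, after those in `s m` whose block also meets row `m - 1`, where it
contributes `ω m`. -/
theorem exists_ready_of_lists {a : Fin K → ℝ} {d : Fin K → ℕ} {lam : Fin M → ℝ}
    (ha : ∀ k, 0 < a k) (hlam : ∀ m, 0 < lam m) {L s : ℕ → List (Fin K)} {ω : ℕ → ℝ}
    (hnodup : ∀ m, m < M → (L m ++ s (m + 1)).Nodup)
    (hprefix : ∀ m, m < M → s m <+: L m) (hne : ∀ m, m < M → L m ≠ [])
    (hsum : ∀ j, j ≤ M → ∑ i ∈ Finset.range j, ((L i).map fun k => a k ^ 2).sum + ω j =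
      partialSum lam j)
    (hblock : ∀ j, j ≤ M → (s j = [] ∧ ω j = 0) ∨ (j < M ∧ ∃ k₁ k₂, s j = [k₁, k₂] ∧
      0 < ω j ∧ ω j < a k₁ ^ 2 ∧ ω j ≤ a k₂ ^ 2))
    (hcount : ∀ k, ∑ i ∈ Finset.range M, (L i).count k = d k) :
    ∃ (σ : Fin (∑ k, d k) ≃ Copies d) (p : ℕ → ℕ), IsReady (fun n => a (σ n).1) lam p ∧
      WindowConditions (fun n => a (σ n).1) lam p (fun n => (σ n).1) := by
  set ℓ := concat L M with hℓ
  have hlen : ℓ.length = ∑ k, d k := by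
    have := Multiset.sum_count_eq_card (s := Finset.univ) (m := (ℓ : Multiset (Fin K)))
      fun _ _ => Finset.mem_univ _
    rw [← Multiset.coe_card, ← this]
    exact Finset.sum_congr rfl fun k _ => by rw [Multiset.coe_count, count_concat, hcount]
  set c : Fin (∑ k, d k) → Fin K := fun n => ℓ[(n : ℕ)]'(by rw [hlen]; exact n.2) with hcdef
  have hc : ∀ n : Fin (∑ k, d k), ℓ[(n : ℕ)]? = some (c n) := fun n =>
    List.getElem?_eq_getElem _
  have hmap : Finset.univ.val.map c = (ℓ : Multiset (Fin K)) := by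
    rw [Fin.univ_val_map]
    congr 1
    refine List.ext_getElem? fun i => ?_
    by_cases hi : i < ∑ k, d k
    · rw [hc ⟨i, hi⟩, List.getElem?_ofFn, dif_pos hi]
    · rw [List.getElem?_eq_none (by simpa using hi), List.getElem?_eq_none (by omega)]
  -- Each label occurs `d k` times, so the positions match the copies with labels preserved; which
  -- copy of a label goes where is immaterial.
  have hfiber : ∀ k, Fintype.card {n // c n = k} = Fintype.card {x : Copies d // x.1 = k} := by
    intro k
    rw [card_fiber_eq_count, hmap, Multiset.coe_count, count_concat, hcount]
    exact (card_copies d (Equiv.refl _) k).symm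
  set σ : Fin (∑ k, d k) ≃ Copies d :=
    Equiv.ofFiberEquiv (f := c) (g := fun x : Copies d => x.1) fun k =>
      Fintype.equivOfCardEq (hfiber k)
  have hσ : ∀ n, (σ n).1 = c n := fun n => Equiv.ofFiberEquiv_map _ n
  set p : ℕ → ℕ := fun j => (concat L j).length with hp
  have hp_succ : ∀ j, p (j + 1) = p j + (L j).length := fun j => by simp [hp, concat]
  have hpre : ∀ j, j ≤ M → concat L j <+: ℓ := fun j hj => concat_prefix L hj
  have hsq : ∀ j, j ≤ M → partialSqSum (fun n => a (c n)) (p j) = partialSum lam j - ω j := by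
    intro j hj
    obtain ⟨C, hC⟩ := hpre j hj
    rw [partialSqSum_label a hlen hc, ← hC, hp, List.take_left, sum_map_concat, ← hsum j hj]
    ring
  have hres : ∀ j, j ≤ M → residue (fun n => a (c n)) lam p j = ω j := fun j hj => by
    rw [residue, hsq j hj]; ring
  have hseq : ∀ j, j < M → ∀ i x, (L j)[i]? = some x →
      seqAt (fun n => a (c n)) (p j + i) = a x := by
    intro j hj i x hx
    obtain ⟨C, hC⟩ := hpre (j + 1) hj
    have hi : i < (L j).length := (List.getElem?_eq_some_iff.1 hx).1
    rw [seqAt_label a hlen hc, ← hC, concat, List.append_assoc,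
      List.getElem?_append_right (by simp [hp]), hp]
    simp only [Nat.add_sub_cancel_left]
    rw [List.getElem?_append_left hi, hx]
    rfl
  have hpM : p M = ∑ k, d k := hlen
  have hωM : ω M = 0 := by
    rcases hblock M le_rfl with h | h
    · exact h.2
    · exact absurd h.1 (lt_irrefl _)
  have hready : IsReady (fun n => a (c n)) lam p := by
    refine ⟨fun n => ha _, hlam, ?_, rfl, ?_, hpM, ?_, ?_⟩
    · have h1 := hsq M le_rfl
      rw [hpM, hωM, sub_zero, partialSqSum, Finset.sum_range, partialSum, sum_range_seqAt] at h1
      rw [← h1]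
      exact Finset.sum_congr rfl fun n _ => by rw [seqAt_of_lt _ n.2]
    · intro k hk
      have := List.length_pos_of_ne_nil (hne k hk)
      rw [hp_succ]; omega
    · intro j _ hj
      rw [partialSqSum_succ, hsq j hj.le]
      rcases hblock j hj.le with ⟨-, h0⟩ | ⟨-, k₁, k₂, hs, h0, h1, -⟩
      · obtain ⟨x, t, hx⟩ := List.exists_cons_of_ne_nil (hne j hj)
        have := hseq j hj 0 x (by rw [hx]; rfl)
        rw [add_zero] at this
        rw [this, h0]
        have := pow_pos (ha x) 2
        constructor <;> linarith
      · obtain ⟨t, ht⟩ := hprefix j hj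
        have := hseq j hj 0 k₁ (by rw [← ht, hs]; rfl)
        rw [add_zero] at this
        rw [this]
        constructor <;> linarith
    · intro j _ hj hlt
      rw [hsq j hj.le] at hlt ⊢
      rcases hblock j hj.le with ⟨-, h0⟩ | ⟨-, k₁, k₂, hs, h0, -, h2⟩
      · rw [h0, sub_zero] at hlt; exact absurd hlt (lt_irrefl _)
      · obtain ⟨t, ht⟩ := hprefix j hj
        rw [hseq j hj 1 k₂ (by rw [← ht, hs]; rfl), hp_succ, ← ht, hs]
        exact ⟨by simp, by linarith⟩
  refine ⟨σ, p, ?_⟩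
  simp only [hσ]
  refine ⟨hready, (windowConditions_iff hready c).2 fun k hk => ?_⟩
  rw [windowEnd, hres (k + 1) hk]
  split_ifs with hω
  · rcases hblock (k + 1) hk with ⟨-, h0⟩ | ⟨hk', k₁, k₂, hs, -⟩
    · exact absurd h0 hω.ne'
    -- The two columns past the end of row `k` are those of `s (k + 1)`, because it is a prefix of
    -- `L (k + 1)`.
    · have hpp : concat L k ++ (L k ++ s (k + 1)) <+: ℓ := by
        refine List.IsPrefix.trans ?_ (hpre (k + 2) hk')
        rw [concat, concat, List.append_assoc, List.prefix_append_right_inj,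
          List.prefix_append_right_inj]
        exact hprefix _ hk'
      have := noRepeat_of_nodup hc hpp (hnodup k hk)
      rwa [List.length_append, hs, ← add_assoc, ← List.length_append] at this
  · have := noRepeat_of_nodup hc (hpre (k + 1) hk) (hnodup k hk).of_append_left
    rwa [← List.length_append] at this

end

section

variable {M N K : ℕ}

/-! ### Tight frames -/

section

variable {ι : Type} [Fintype ι] {W : Submodule ℝ (Eucl M)} {f : ι → Eucl M} {r : ℝ}

lemma frameOperator_mem (hf : IsTightFrameFor W f r) (v : Eucl M) : frameOperator f v ∈ W := by
  rw [frameOperator_apply]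
  exact Submodule.sum_mem _ fun n _ => Submodule.smul_mem _ _ (hf.2.1 n)

/-- By polarization, the difference of the two sides is orthogonal to all of `W`; it also lies in
`W`, so it is zero. -/
lemma frameOperator_of_mem (hf : IsTightFrameFor W f r) {v : Eucl M} (hv : v ∈ W) :
    frameOperator f v = r • v := by
  have polar : ∀ u ∈ W, ∑ n, inner ℝ u (f n) * inner ℝ v (f n) = r * inner ℝ u v := by
    intro u hu
    have h1 := hf.2.2 (u + v) (W.add_mem hu hv)
    have h2 := hf.2.2 u hu
    have h3 := hf.2.2 v hv
    simp only [inner_add_left, add_sq, Finset.sum_add_distrib, mul_assoc] at h1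
    rw [← Finset.mul_sum, norm_add_sq_real] at h1
    linarith
  set w := frameOperator f v - r • v with hw
  have hwW : w ∈ W := W.sub_mem (frameOperator_mem hf v) (W.smul_mem r hv)
  have h0 : inner ℝ w w = 0 := by
    have h1 : inner ℝ w (frameOperator f v) = r * inner ℝ w v := by
      rw [← polar w hwW, frameOperator_apply, inner_sum]
      exact Finset.sum_congr rfl fun n _ => by
        rw [real_inner_smul_right, real_inner_comm, mul_comm]
    conv_lhs => rw [hw]
    rw [inner_sub_left, real_inner_comm, h1, real_inner_smul_left, real_inner_comm w v, sub_self]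
  exact sub_eq_zero.1 (inner_self_eq_zero.1 h0)

/-- The frame operator of a tight frame with bound `r` is `r` times a projection. -/
lemma tightFrame_gram_mul (hf : IsTightFrameFor W f r) (i j : Fin M) :
    ∑ l, (∑ n, f n i * f n l) * ∑ n, f n l * f n j = r * ∑ n, f n i * f n j := by
  have happ : ∀ v (i : Fin M), frameOperator f v i = ∑ l, (∑ n, f n i * f n l) * v l := by
    intro v i
    rw [frameOperator_apply, WithLp.ofLp_sum, Finset.sum_apply]
    simp only [PiLp.smul_apply, smul_eq_mul, PiLp.inner_apply, RCLike.inner_apply, conj_trivial,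
      Finset.sum_mul]
    rw [Finset.sum_comm]
    exact Finset.sum_congr rfl fun l _ => Finset.sum_congr rfl fun n _ => by ring
  have hcol : ∀ l, frameOperator f (EuclideanSpace.single j 1) l = ∑ n, f n l * f n j := by
    intro l
    rw [happ, Finset.sum_eq_single j] <;> simp +contextual
  have := congrArg (fun v : Eucl M => v i) (frameOperator_of_mem hf
    (frameOperator_mem hf (EuclideanSpace.single j 1)))
  simp only [PiLp.smul_apply, smul_eq_mul, hcol] at this
  rw [happ] at this
  simpa only [hcol] using this

/-- Sum the tight frame identity over an orthonormal basis of `W`: each basis vector contributes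
`r`, and each `f n` contributes its squared norm. -/
lemma tightFrame_trace (hf : IsTightFrameFor W f r) :
    ∑ i, ∑ n, f n i * f n i = r * Module.finrank ℝ W := by
  have h1 : ∀ n, ∑ i, inner ℝ (stdOrthonormalBasis ℝ W i : Eucl M) (f n) ^ 2 =
      ∑ i, f n i * f n i := by
    intro n
    have := (stdOrthonormalBasis ℝ W).sum_sq_inner_right ⟨f n, hf.2.1 n⟩
    simp only [Submodule.coe_inner, Submodule.coe_norm] at this
    rw [this, EuclideanSpace.real_norm_sq_eq]
    exact Finset.sum_congr rfl fun i _ => sq _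
  rw [Finset.sum_comm, ← Finset.sum_congr rfl fun n _ => h1 n, Finset.sum_comm,
    Finset.sum_congr rfl fun i _ => hf.2.2 _ (SetLike.coe_mem (stdOrthonormalBasis ℝ W i))]
  have h2 : ∀ i, ‖(stdOrthonormalBasis ℝ W i : Eucl M)‖ = 1 := fun i => by
    rw [← Submodule.coe_norm]; exact (stdOrthonormalBasis ℝ W).norm_eq_one i
  simp [h2, mul_comm]

end

/-! ### Tridiagonal multiples of projections -/

/-- The upper left `M × M` corner of `G` is tridiagonal, symmetric and `r` times a projection. -/
structure IsTridiagonalProjection (M : ℕ) (r : ℝ) (G : ℕ → ℕ → ℝ) : Prop where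
  symm : ∀ i j, G i j = G j i
  tri : ∀ i j, i + 1 < j → G i j = 0
  mul : ∀ i j, i < M → j < M → ∑ l ∈ Finset.range M, G i l * G l j = r * G i j

namespace IsTridiagonalProjection

variable {r : ℝ} {G : ℕ → ℕ → ℝ}

/-- In entry `(j, j + 2)` of `G ^ 2 = r G` the right side is zero and only the middle index survives
on the left. Thus 2 × 2 blocks never overlap. -/
lemma mul_adjacent (h : IsTridiagonalProjection M r G) {j : ℕ} (hj : j + 2 < M) :
    G j (j + 1) * G (j + 1) (j + 2) = 0 := by
  have := h.mul j (j + 2) (by omega) hj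
  rw [h.tri j (j + 2) (by omega), mul_zero,
    Finset.sum_eq_single_of_mem (j + 1) (Finset.mem_range.2 (by omega))] at this
  · exact this
  · intro l _ hl
    rcases (show l < j + 1 ∨ j + 1 < l by omega) with h' | h'
    · rw [h.tri l (j + 2) (by omega), mul_zero]
    · rw [h.tri j l (by omega), zero_mul]

lemma diag_add (h : IsTridiagonalProjection M r G) {j : ℕ} (hj : j + 1 < M)
    (hG : G j (j + 1) ≠ 0) : G j j + G (j + 1) (j + 1) = r := by
  have := h.mul j (j + 1) (by omega) hj
  rw [← Finset.sum_subset (s₁ := {j, j + 1}), Finset.sum_pair (by omega)] at this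
  · exact mul_right_cancel₀ hG (by linarith)
  · intro l hl
    simp only [Finset.mem_insert, Finset.mem_singleton] at hl
    exact Finset.mem_range.2 (by omega)
  · intro l _ hl
    simp only [Finset.mem_insert, Finset.mem_singleton, not_or] at hl
    rcases (show l < j ∨ j + 1 < l by omega) with h' | h'
    · rw [h.tri l (j + 1) (by omega), mul_zero]
    · rw [h.tri j l (by omega), zero_mul]

/-- Entry `(j, j)` of `G ^ 2 = r G`, with `r` replaced by the trace from `diag_add`, says that the 2
× 2 block has determinant zero. -/
lemma diag_mul (h : IsTridiagonalProjection M r G) {j : ℕ} (hj : j + 1 < M)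
    (hG : G j (j + 1) ≠ 0) : G j j * G (j + 1) (j + 1) = G j (j + 1) ^ 2 := by
  have h1 := h.mul j j (by omega) (by omega)
  rw [← Finset.sum_subset (s₁ := {j, j + 1}), Finset.sum_pair (by omega), h.symm (j + 1) j] at h1
  · rw [← h.diag_add hj hG] at h1
    linarith
  · intro l hl
    simp only [Finset.mem_insert, Finset.mem_singleton] at hl
    exact Finset.mem_range.2 (by omega)
  · intro l _ hl
    simp only [Finset.mem_insert, Finset.mem_singleton, not_or] at hl
    rcases (show l + 1 < j ∨ l + 1 = j ∨ j + 1 < l by omega) with h' | h' | h'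
    · rw [h.tri l j (by omega), mul_zero]
    · subst h'
      rw [(mul_eq_zero.1 (h.mul_adjacent hj)).resolve_right hG, mul_zero]
    · rw [h.tri j l (by omega), zero_mul]

lemma diag_pos (h : IsTridiagonalProjection M r G) {j : ℕ} (hj : j + 1 < M)
    (hG : G j (j + 1) ≠ 0) : G j j ≠ 0 ∧ G (j + 1) (j + 1) ≠ 0 :=
  mul_ne_zero_iff.1 (h.diag_mul hj hG ▸ pow_ne_zero 2 hG)

lemma diag_eq_zero_or (h : IsTridiagonalProjection M r G) {m : ℕ} (hm : m < M)
    (hleft : ∀ j, j + 1 = m → G j m = 0) (hright : m + 1 < M → G m (m + 1) = 0) :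
    G m m = 0 ∨ G m m = r := by
  have h1 := h.mul m m hm hm
  rw [Finset.sum_eq_single_of_mem m (Finset.mem_range.2 hm)] at h1
  · rcases mul_eq_zero.1 (show G m m * (G m m - r) = 0 by linarith) with h2 | h2
    · exact Or.inl h2
    · exact Or.inr (sub_eq_zero.1 h2)
  · intro l hl hne
    have hl' := Finset.mem_range.1 hl
    rcases (show l + 1 < m ∨ l + 1 = m ∨ l = m + 1 ∨ m + 1 < l by omega) with h' | h' | h' | h'
    · rw [h.tri l m h', mul_zero]
    · rw [hleft l h', mul_zero]
    · subst h'; rw [hright hl', zero_mul]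
    · rw [h.tri m l h', zero_mul]

end IsTridiagonalProjection

end

/-! ### Frame operators of single labels and the new ordering. -/

section

variable {M N K : ℕ}

/-- The matrix of the frame operator of the vectors with label `k`. -/
def labelGram (J : Fin N → Fin K) (v : ℕ → ℕ → ℝ) (k : Fin K) (i j : ℕ) : ℝ :=
  ∑ n : Fin N, if J n = k then v n i * v n j else 0

section

variable {b : Fin N → ℝ} {lam : Fin M → ℝ} {p : ℕ → ℕ} {v : ℕ → ℕ → ℝ} {J : Fin N → Fin K}

lemma labelGram_eq_sum_subtype (k : Fin K) (i j : ℕ) :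
    labelGram J v k i j = ∑ n : {n // J n = k}, v n i * v n j := by
  rw [labelGram, ← Finset.sum_filter]
  exact Finset.sum_subtype _ (by simp) _

lemma labelGram_symm (k : Fin K) (i j : ℕ) : labelGram J v k i j = labelGram J v k j i :=
  Finset.sum_congr rfl fun n _ => by rw [mul_comm]

lemma labelGram_tri (h : IsReady b lam p) (ho : IsOutput b lam p v) (k : Fin K) (i j : ℕ)
    (hij : i + 1 < j) : labelGram J v k i j = 0 := by
  refine Finset.sum_eq_zero fun n _ => ?_
  by_contra hne
  obtain ⟨h1, h2⟩ := mul_ne_zero_iff.1 (fun h0 => hne (by rw [h0, ite_self]))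
  have := (ho.adjacent h n.2 h1 h2 (by omega)).1
  omega

lemma sum_labelGram (ho : IsOutput b lam p v) (i : ℕ) :
    ∑ k, labelGram J v k i i = seqAt lam i := by
  simp only [labelGram]
  rw [Finset.sum_comm]
  simp only [Finset.sum_ite_eq, Finset.mem_univ, if_true]
  rw [← Finset.sum_range (fun n => v n i * v n i), ho.gram, if_pos rfl]

lemma sq_le_labelGram (n : Fin N) (i : ℕ) : v n i ^ 2 ≤ labelGram J v (J n) i i := by
  have := Finset.single_le_sum (f := fun m : Fin N => if J m = J n then v m i * v m i else 0)
    (fun m _ => by split_ifs; exacts [mul_self_nonneg _, le_rfl]) (Finset.mem_univ n)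
  simp only [if_true] at this
  rw [sq]
  exact this

lemma labelGram_block (h : IsReady b lam p) (ho : IsOutput b lam p v) (k : Fin K) {j : ℕ}
    {n₁ n₂ : Fin N} (h₁ : (n₁ : ℕ) = p (j + 1)) (h₂ : (n₂ : ℕ) = p (j + 1) + 1) :
    labelGram J v k j (j + 1) = (if J n₁ = k then v n₁ j * v n₁ (j + 1) else 0) +
      if J n₂ = k then v n₂ j * v n₂ (j + 1) else 0 := by
  have hne : n₁ ≠ n₂ := fun h0 => by rw [h0] at h₁; omega
  rw [labelGram, ← Finset.sum_subset (Finset.subset_univ {n₁, n₂}), Finset.sum_pair hne]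
  intro n _ hn
  simp only [Finset.mem_insert, Finset.mem_singleton, not_or] at hn
  by_contra hne'
  obtain ⟨h3, h4⟩ := mul_ne_zero_iff.1 (fun h0 => hne' (by rw [h0, ite_self]))
  rcases (ho.adjacent h n.2 h3 h4 (by omega)).2.2.2 with h5 | h5
  · exact hn.1 (Fin.ext (h5.trans h₁.symm))
  · exact hn.2 (Fin.ext (h5.trans h₂.symm))

/-- The labels that occur off the diagonal at the rows `j`, `j + 1`: none, or the two different
labels of the block, which then has the norms that belong to its labels. -/
lemma exists_block_labels {a : Fin K → ℝ} (h : IsReady b lam p) (ho : IsOutput b lam p v)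
    (hproj : ∀ k, IsTridiagonalProjection M (a k ^ 2) (labelGram J v k)) {j : ℕ}
    (hj : j + 1 < M) :
    ∃ l : List (Fin K), l.Nodup ∧ (∀ k, k ∈ l ↔ labelGram J v k j (j + 1) ≠ 0) ∧
      (l = [] ∨ ∃ k₁ k₂, l = [k₁, k₂] ∧ 0 < residue b lam p (j + 1) ∧
        residue b lam p (j + 1) < a k₁ ^ 2 ∧ residue b lam p (j + 1) ≤ a k₂ ^ 2 ∧
        labelGram J v k₁ j j + labelGram J v k₂ j j = residue b lam p (j + 1)) := by
  by_cases hzero : ∀ k, labelGram J v k j (j + 1) = 0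
  · exact ⟨[], List.nodup_nil, fun k => by simp [hzero], Or.inl rfl⟩
  have hr : 0 < residue b lam p (j + 1) := by
    by_contra hr
    refine hzero fun k => Finset.sum_eq_zero fun n _ => ?_
    by_contra hne
    obtain ⟨h1, h2⟩ := mul_ne_zero_iff.1 (fun h0 => hne (by rw [h0, ite_self]))
    exact hr (ho.adjacent h n.2 h1 h2 (by omega)).2.2.1
  obtain ⟨hp2, hle⟩ := h.block' (k := j + 1) (by omega) hj hr
  have hN := h.le_N (k := j + 1 + 1) (by omega)
  have hlt := h.residue_lt (k := j + 1) (by omega) hj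
  obtain ⟨α, β, γ, δ, hu, hw, hα, hβ, hγ, hδ, hαβ, h1, h2, h3, -⟩ := ho.block j hj hr
  set n₁ : Fin N := ⟨p (j + 1), by omega⟩ with hn₁
  set n₂ : Fin N := ⟨p (j + 1) + 1, by omega⟩ with hn₂
  have e1 : v n₁ j = α := by simp only [hn₁, hu, smul_e_add_apply, if_true]
  have e2 : v n₁ (j + 1) = β := by
    simp only [hn₁, hu, smul_e_add_apply, Nat.succ_ne_self, if_false, if_true]
  have e3 : v n₂ j = γ := by simp only [hn₂, hw, smul_e_sub_apply, if_true]
  have e4 : v n₂ (j + 1) = -δ := by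
    simp only [hn₂, hw, smul_e_sub_apply, Nat.succ_ne_self, if_false, if_true]
  have hG : ∀ k, labelGram J v k j (j + 1) = (if J n₁ = k then α * β else 0) -
      if J n₂ = k then α * β else 0 := by
    intro k
    rw [labelGram_block h ho k (n₁ := n₁) (n₂ := n₂) rfl rfl, e1, e2, e3, e4, mul_neg, ← hαβ]
    split_ifs <;> ring
  have hαβ0 : α * β ≠ 0 := fun h0 => hzero fun k => by simp [hG, h0]
  have hδ' : δ ≠ 0 := fun h0 => hαβ0 (by rw [hαβ, h0, mul_zero])
  have hk : J n₁ ≠ J n₂ := fun h0 => hzero fun k => by rw [hG, h0, sub_self]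
  have hG1 : labelGram J v (J n₁) j (j + 1) = α * β := by
    rw [hG, if_pos rfl, if_neg hk.symm, sub_zero]
  have hG2 : labelGram J v (J n₂) j (j + 1) = -(γ * δ) := by
    rw [hG, if_pos rfl, if_neg hk, zero_sub, hαβ]
  -- A diagonal entry is at least the square contributed by the block column, while the product of
  -- the two entries is the product of those squares. Equality follows in both: no other column with
  -- this label meets these rows.
  have squeeze : ∀ {s t x y : ℝ}, 0 < s → 0 < t → s ≤ x → t ≤ y → x * y = s * t →
      x = s ∧ y = t := by
    intro s t x y hs ht hx hy hxy
    constructor <;> nlinarith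
  have hne1 : labelGram J v (J n₁) j (j + 1) ≠ 0 := by rw [hG1]; exact hαβ0
  have hne2 : labelGram J v (J n₂) j (j + 1) ≠ 0 := by
    rw [hG2]; exact neg_ne_zero.2 (mul_ne_zero hγ.ne' hδ')
  have hα0 : α ≠ 0 := left_ne_zero_of_mul hαβ0
  have q1 : α ^ 2 ≤ labelGram J v (J n₁) j j := e1 ▸ sq_le_labelGram n₁ j
  have q2 : β ^ 2 ≤ labelGram J v (J n₁) (j + 1) (j + 1) := e2 ▸ sq_le_labelGram n₁ (j + 1)
  have q3 : γ ^ 2 ≤ labelGram J v (J n₂) j j := e3 ▸ sq_le_labelGram n₂ j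
  have q4 : δ ^ 2 ≤ labelGram J v (J n₂) (j + 1) (j + 1) := by
    rw [← neg_sq]; exact e4 ▸ sq_le_labelGram n₂ (j + 1)
  obtain ⟨d1, d2⟩ := squeeze (by positivity) (by positivity) q1 q2
    (by rw [(hproj _).diag_mul hj hne1, hG1, mul_pow])
  obtain ⟨d3, d4⟩ := squeeze (by positivity) (by positivity) q3 q4
    (by rw [(hproj _).diag_mul hj hne2, hG2]; ring)
  -- The trace identity now says that the squared norm of the block column is the squared weight of
  -- its label.
  have a1 := (hproj _).diag_add hj hne1
  have a2 := (hproj _).diag_add hj hne2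
  rw [d1, d2, h1] at a1
  rw [d3, d4, h2] at a2
  refine ⟨[J n₁, J n₂], by simpa using hk, fun k => ?_, Or.inr ⟨_, _, rfl, hr, a1 ▸ hlt,
    a2 ▸ hle, by rw [d1, d3, h3]⟩⟩
  rw [hG]
  by_cases hk1 : J n₁ = k
  · subst hk1; simpa [hk.symm] using mul_ne_zero_iff.1 hαβ0
  · by_cases hk2 : J n₂ = k
    · subst hk2; simpa [hk] using mul_ne_zero_iff.1 hαβ0
    · simp [hk1, hk2, Ne.symm hk1, Ne.symm hk2]

end

lemma sum_map_eq_sum_count {α : Type*} [Fintype α] [DecidableEq α] (f : α → ℝ) (l : List α) :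
    (l.map f).sum = ∑ x, f x * l.count x := by
  induction l with
  | nil => simp
  | cons y l ih =>
    rw [List.map_cons, List.sum_cons, ih]
    simp only [List.count_cons, Nat.cast_add, mul_add, Finset.sum_add_distrib]
    rw [add_comm]
    simp

/-- Row `m` receives first the labels of a surviving block on rows `m - 1`, `m`, then a singleton
for every label with diagonal entry `a k ^ 2`. A block between columns of equal label has no
off-diagonal entry and disappears, so new residues are zero or the old ones. -/
theorem exists_ready_of_labelGram {b : Fin N → ℝ} {lam : Fin M → ℝ} {p : ℕ → ℕ}
    {v : ℕ → ℕ → ℝ} {J : Fin N → Fin K} {a : Fin K → ℝ} {d : Fin K → ℕ}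
    (ha : ∀ k, 0 < a k) (h : IsReady b lam p) (ho : IsOutput b lam p v)
    (hproj : ∀ k, IsTridiagonalProjection M (a k ^ 2) (labelGram J v k))
    (htr : ∀ k, ∑ m ∈ Finset.range M, labelGram J v k m m = a k ^ 2 * d k) :
    ∃ (σ : Fin (∑ k, d k) ≃ Copies d) (p : ℕ → ℕ), IsReady (fun n => a (σ n).1) lam p ∧
      WindowConditions (fun n => a (σ n).1) lam p (fun n => (σ n).1) := by
  classical
  set G := labelGram J v with hG
  have hl : ∀ j, ∃ l : List (Fin K), l.Nodup ∧ (∀ k, k ∈ l ↔ j + 1 < M ∧ G k j (j + 1) ≠ 0) ∧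
      (l = [] ∨ ∃ k₁ k₂, l = [k₁, k₂] ∧ 0 < residue b lam p (j + 1) ∧
        residue b lam p (j + 1) < a k₁ ^ 2 ∧ residue b lam p (j + 1) ≤ a k₂ ^ 2 ∧
        G k₁ j j + G k₂ j j = residue b lam p (j + 1)) := by
    intro j
    by_cases hj : j + 1 < M
    · obtain ⟨l, h1, h2, h3⟩ := exists_block_labels h ho hproj hj
      exact ⟨l, h1, fun k => by rw [h2]; simp [hj, hG], h3⟩
    · exact ⟨[], List.nodup_nil, fun k => by simp [hj], Or.inl rfl⟩
  choose l hlnd hlmem hlcases using hl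
  set s : ℕ → List (Fin K) := fun j => Nat.casesOn j [] l with hs
  set T : ℕ → List (Fin K) := fun m =>
    (Finset.univ.filter fun k => G k m m = a k ^ 2).toList with hT
  -- The mass that a block starting in row `j` places in row `j - 1`, for label `k`; summed over `k`
  -- it is the new residue `ω j`.
  set w : ℕ → Fin K → ℝ := fun j k =>
    Nat.casesOn j 0 (fun j => if k ∈ l j then G k j j else 0) with hw
  set ω : ℕ → ℝ := fun j => ∑ k, w j k with hω
  have hTmem : ∀ m k, k ∈ T m ↔ G k m m = a k ^ 2 := fun m k => by simp [hT]
  have hsnd : ∀ j, (s j).Nodup := fun j => by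
    cases j with
    | zero => exact List.nodup_nil
    | succ j => exact hlnd j
  have hTnd : ∀ m, (T m).Nodup := fun m => Finset.nodup_toList _
  -- The labels of a block occur in both of its rows only there.
  have hupper : ∀ m k, k ∈ s m → k ∉ T m := by
    intro m k hk hkT
    cases m with
    | zero => exact absurd hk List.not_mem_nil
    | succ j =>
      obtain ⟨hj, hne⟩ := (hlmem j k).1 hk
      have h1 := (hproj k).diag_add hj hne
      have h2 := ((hproj k).diag_pos hj hne).1
      rw [hTmem] at hkT
      exact h2 (by linarith)
  have hlower : ∀ m k, k ∈ s (m + 1) → k ∉ T m := by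
    intro m k hk hkT
    obtain ⟨hj, hne⟩ := (hlmem m k).1 hk
    have h1 := (hproj k).diag_add hj hne
    have h2 := ((hproj k).diag_pos hj hne).2
    rw [hTmem] at hkT
    exact h2 (by linarith)
  have hboth : ∀ m k, k ∈ s m → k ∉ s (m + 1) := by
    intro m k hk hk'
    cases m with
    | zero => exact absurd hk List.not_mem_nil
    | succ j =>
      obtain ⟨hj, hne⟩ := (hlmem j k).1 hk
      obtain ⟨hj', hne'⟩ := (hlmem (j + 1) k).1 hk'
      exact mul_ne_zero hne hne' ((hproj k).mul_adjacent hj')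
  -- Mass balance of one label in one row: the weights starting there, plus the part borrowed from
  -- the next block, minus the part already spent in the previous row.
  have hrow : ∀ m, m < M → ∀ k, G k m m =
      a k ^ 2 * ((s m ++ T m).count k : ℕ) + w (m + 1) k - w m k := by
    intro m hm k
    rw [List.count_append, (hsnd m).count, (hTnd m).count]
    by_cases h1 : k ∈ s m
    · cases m with
      | zero => exact absurd h1 List.not_mem_nil
      | succ j =>
        obtain ⟨hj, hne⟩ := (hlmem j k).1 h1
        have h2 : w (j + 1 + 1) k = 0 := if_neg (hboth _ k h1)
        have h3 : w (j + 1) k = G k j j := if_pos h1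
        have h4 := (hproj k).diag_add hj hne
        rw [if_pos h1, if_neg (hupper _ k h1), h2, h3]
        push_cast
        linarith
    · have h2 : w m k = 0 := by
        cases m with
        | zero => rfl
        | succ j => exact if_neg h1
      by_cases h3 : k ∈ s (m + 1)
      · have h4 : w (m + 1) k = G k m m := if_pos h3
        rw [if_neg h1, if_neg (hlower _ k h3), h2, h4]
        simp
      · have h4 : w (m + 1) k = 0 := if_neg h3
        rw [if_neg h1, h2, h4]
        have h5 : G k m m = 0 ∨ G k m m = a k ^ 2 := by
          refine (hproj k).diag_eq_zero_or hm (fun j hj => ?_) (fun hm' => ?_)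
          · subst hj
            by_contra hne
            exact h1 ((hlmem j k).2 ⟨hm, hne⟩)
          · by_contra hne
            exact h3 ((hlmem m k).2 ⟨hm', hne⟩)
        by_cases h6 : k ∈ T m
        · rw [if_pos h6, (hTmem m k).1 h6]; simp
        · rw [if_neg h6, h5.resolve_right fun h7 => h6 ((hTmem m k).2 h7)]; simp
  have hω0 : ω 0 = 0 := by simp [hω, hw]
  have hωsucc : ∀ j, (s (j + 1) = [] ∧ ω (j + 1) = 0) ∨ (j + 1 < M ∧
      ∃ k₁ k₂, s (j + 1) = [k₁, k₂] ∧ 0 < residue b lam p (j + 1) ∧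
      residue b lam p (j + 1) < a k₁ ^ 2 ∧ residue b lam p (j + 1) ≤ a k₂ ^ 2 ∧
      ω (j + 1) = residue b lam p (j + 1)) := by
    intro j
    rcases hlcases j with h1 | ⟨k₁, k₂, h1, h2, h3, h4, h5⟩
    · refine Or.inl ⟨h1, ?_⟩
      simp [hω, hw, h1]
    · refine Or.inr ⟨((hlmem j k₁).1 (by simp [h1])).1, k₁, k₂, h1, h2, h3, h4, ?_⟩
      have hnd := hlnd j
      rw [h1] at hnd
      have hk : k₁ ≠ k₂ := by simpa using hnd
      have hmem : ∀ k, k ∈ l j ↔ k ∈ ({k₁, k₂} : Finset (Fin K)) := fun k => by simp [h1]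
      rw [← h5, ← Finset.sum_pair (f := fun k => G k j j) hk]
      simp only [hω, hw, hmem]
      rw [Finset.sum_ite_mem, Finset.univ_inter]
  have hlam_row : ∀ m, m < M → seqAt lam m =
      ((s m ++ T m).map fun k => a k ^ 2).sum + ω (m + 1) - ω m := by
    intro m hm
    rw [← sum_labelGram ho m (J := J), sum_map_eq_sum_count, ← Finset.sum_add_distrib,
      ← Finset.sum_sub_distrib]
    exact Finset.sum_congr rfl fun k _ => hrow m hm k
  refine exists_ready_of_lists (L := fun m => s m ++ T m) (s := s) (ω := ω) ha
    h.eigenvalues_pos ?_ (fun m _ => List.prefix_append _ _) ?_ ?_ ?_ ?_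
  · intro m _
    refine List.nodup_append'.2 ⟨List.nodup_append'.2 ⟨hsnd m, hTnd m, hupper m⟩, hsnd (m + 1), ?_⟩
    intro k hk hk'
    rcases List.mem_append.1 hk with hk | hk
    · exact hboth m k hk hk'
    · exact hlower m k hk' hk
  · intro m hm hnil
    have h1 := hlam_row m hm
    have h2 : 0 < seqAt lam m := by rw [seqAt_of_lt lam hm]; exact h.eigenvalues_pos _
    have hsm : s m = [] := (List.append_eq_nil_iff.1 hnil).1
    have hωm : ω m = 0 := by
      cases m with
      | zero => exact hω0
      | succ j =>
        rcases hωsucc j with h3 | ⟨-, k₁, k₂, h3, -⟩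
        · exact h3.2
        · rw [h3] at hsm; exact absurd hsm (List.cons_ne_nil _ _)
    simp only [hnil, List.map_nil, List.sum_nil, hωm] at h1
    rcases hωsucc m with h3 | ⟨hm', -, -, -, -, -, -, h3⟩
    · rw [h3.2] at h1; linarith
    -- An empty row would have the old residue at `m + 1` equal to the whole of `lam m`, but the old
    -- column `p m` already reaches past the first `m` eigenvalues.
    · rw [h3, residue, partialSum_succ] at h1
      have h4 : partialSqSum b (p m + 1) ≤ partialSqSum b (p (m + 1)) :=
        partialSqSum_mono b (h.strict m hm)
      have h5 : partialSum lam m < partialSqSum b (p m + 1) := by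
        rcases Nat.eq_zero_or_pos m with rfl | h0
        · rw [partialSqSum_succ, h.start]
          have hN : 0 < N := by
            have := h.strict 0 hm
            have := h.le_N (k := 0 + 1) (by omega)
            omega
          have := pow_pos (h.seqAt_pos hN) 2
          simpa using this
        · exact (h.cut m h0 hm).2
      linarith
  · intro j hj
    induction j with
    | zero => simp [hω0]
    | succ j ih =>
      rw [Finset.sum_range_succ, partialSum_succ, hlam_row j hj, ← ih (by omega)]
      ring
  · intro j _
    cases j with
    | zero => exact Or.inl ⟨rfl, hω0⟩
    | succ j =>
      refine (hωsucc j).imp_right ?_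
      rintro ⟨hj, k₁, k₂, h1, h2, h3, h4, h5⟩
      exact ⟨hj, k₁, k₂, h1, h5 ▸ h2, h5 ▸ h3, h5 ▸ h4⟩
  · intro k
    -- Telescoping the mass balance turns the trace `a k ^ 2 * d k` into the count of the label, as
    -- no block starts past the last row.
    have htel : ∀ j, j ≤ M → ∑ m ∈ Finset.range j, G k m m =
        a k ^ 2 * (∑ m ∈ Finset.range j, (s m ++ T m).count k : ℕ) + w j k := by
      intro j hj
      induction j with
      | zero => simp [hw]
      | succ j ih =>
        rw [Finset.sum_range_succ, Finset.sum_range_succ, ih (by omega), hrow j hj]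
        push_cast
        ring
    have hwM : w M k = 0 := by
      rcases hM : M with _ | j
      · rfl
      · refine if_neg fun hk => ?_
        have := ((hlmem j k).1 hk).1
        omega
    have h1 := htel M le_rfl
    rw [htr, hwM, add_zero] at h1
    exact (Nat.cast_injective (mul_left_cancel₀ (pow_pos (ha k) 2).ne' h1)).symm

/-- If spectral tetris can construct the data, then some ordering meets the window conditions. -/
theorem Constructible.exists_windowConditions {a : Fin K → ℝ} {d : Fin K → ℕ} {lam : Fin M → ℝ}
    (hc : Constructible a d lam) :
    ∃ (σ : Fin (∑ k, d k) ≃ Copies d) (σ' : Equiv.Perm (Fin M)) (p : ℕ → ℕ),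
      IsReady (fun n => a (σ n).1) (fun m => lam (σ' m)) p ∧
      WindowConditions (fun n => a (σ n).1) (fun m => lam (σ' m)) p (fun n => (σ n).1) := by
  obtain ⟨W, hdim, ⟨⟨ha, -⟩, N, f, J, ⟨-, b, μ, p, h, rfl⟩, hop, htight⟩, heig⟩ := hc
  obtain ⟨v, ho, hv⟩ := exists_isOutput h
  rw [← hop] at heig
  -- The diagonal operator has eigenvalues `μ`, so `μ` is a rearrangement of `lam`.
  obtain ⟨σ', hσ'⟩ := exists_perm_of_map_eq
    ((hasEigenvalues_of_diagonal (frameOperator_stc h)).symm.trans heig)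
  have hgram : ∀ k (i j : Fin M), labelGram J v k i j =
      ∑ n : {n // J n = k}, stc b μ n i * stc b μ n j := fun k i j => by
    rw [labelGram_eq_sum_subtype]
    exact Finset.sum_congr rfl fun n _ => by rw [hv, hv]
  have hproj : ∀ k, IsTridiagonalProjection M (a k ^ 2) (labelGram J v k) := by
    refine fun k => ⟨labelGram_symm k, labelGram_tri h ho k, fun i j hi hj => ?_⟩
    rw [Finset.sum_range]
    have := tightFrame_gram_mul (htight k) ⟨i, hi⟩ ⟨j, hj⟩
    simpa only [← hgram] using this
  have htr : ∀ k, ∑ m ∈ Finset.range M, labelGram J v k m m = a k ^ 2 * d k := by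
    intro k
    have := tightFrame_trace (htight k)
    rw [Finset.sum_range, ← hdim k, ← this]
    exact Finset.sum_congr rfl fun m _ => hgram k m m
  obtain ⟨σ, q, h1, h2⟩ := exists_ready_of_labelGram ha h ho hproj htr
  have hμ : μ = fun m => lam (σ' m) := funext fun m => (hσ' m).symm
  subst hμ
  exact ⟨σ, σ', q, h1, h2⟩

end

end SpectralTetris

end

open SpectralTetris in
theorem mainTheorem1 {K M : ℕ} (a : Fin K → ℝ) (d : Fin K → ℕ) (lam : Fin M → ℝ)
    (ha : ∀ k, 0 < a k) (hlam : ∀ m, 0 < lam m) :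
    (Constructible a d lam ↔
      ∃ (σ : Fin (∑ k, d k) ≃ Copies d) (σ' : Equiv.Perm (Fin M)) (p : ℕ → ℕ),
        IsReady (fun n => a (σ n).1) (fun m => lam (σ' m)) p ∧
        WindowConditions (fun n => a (σ n).1) (fun m => lam (σ' m)) p (fun n => (σ n).1)) ∧
    (Constructible a d lam ↔
      ∃ (σ : Fin (∑ k, d k) ≃ Copies d) (σ' : Equiv.Perm (Fin M)) (p : ℕ → ℕ),
        IsReady (fun n => a (σ n).1) (fun m => lam (σ' m)) p ∧
        OrthogonalLabels (stc (fun n => a (σ n).1) (fun m => lam (σ' m))) (fun n => (σ n).1)) ∧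
    (∀ (σ : Fin (∑ k, d k) ≃ Copies d) (σ' : Equiv.Perm (Fin M)) (p : ℕ → ℕ),
      IsReady (fun n => a (σ n).1) (fun m => lam (σ' m)) p →
        (WindowConditions (fun n => a (σ n).1) (fun m => lam (σ' m)) p (fun n => (σ n).1) →
          OrthogonalLabels (stc (fun n => a (σ n).1) (fun m => lam (σ' m)))
            (fun n => (σ n).1)) ∧
        (StrictBlocks (fun n => a (σ n).1) (fun m => lam (σ' m)) p →
          OrthogonalLabels (stc (fun n => a (σ n).1) (fun m => lam (σ' m)))
            (fun n => (σ n).1) →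
          WindowConditions (fun n => a (σ n).1) (fun m => lam (σ' m)) p
            (fun n => (σ n).1))) := by
  refine ⟨⟨fun hc => hc.exists_windowConditions, ?_⟩, ⟨fun hc => ?_, ?_⟩, ?_⟩
  · rintro ⟨σ, σ', p, h, hw⟩
    exact constructible_of_orthogonalLabels ha σ σ' h (orthogonalLabels_of_windowConditions h hw)
  · obtain ⟨σ, σ', p, h, hw⟩ := hc.exists_windowConditions
    exact ⟨σ, σ', p, h, orthogonalLabels_of_windowConditions h hw⟩
  · rintro ⟨σ, σ', p, h, horth⟩
    exact constructible_of_orthogonalLabels ha σ σ' h horth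
  · exact fun σ σ' p h => ⟨orthogonalLabels_of_windowConditions h,
      windowConditions_of_orthogonalLabels h⟩
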